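/- For integers $n\ge 1$, $m\ge 0$ let $G(n,m)$ be the uniformly random simple graph on $V=\{1,\dots,n\}$ with exactly $m$ edges. Throughout, $m=\lceil dn/2\rceil$ with $d$ fixed as $n\to\infty$, and "w.h.p." means with probability tending to $1$ as $n\to\infty$ (with $k$ and $d$ fixed). Write $[k]=\{1,\dots,k\}$. Let $G=(V,E)$ be a graph and $\zeta:V\to\{0,1,\dots,k\}$. A vertex $v$ is *stable* under $\zeta$ if $\zeta(v)\ne0$ and for every $j\in[k]\setminus\{\zeta(v)\}$ there are at least two neighbors $u$ of $v$ with $\zeta(u)=j$. The map $\zeta$ is a *$k$-cover* of $G$ if (1) no edge $\{u,v\}$ has $\zeta(u)=\zeta(v)\neq 0$; (2) every $v$ with $\zeta(v)\ne0$ is stable under $\zeta$; (3) for every $v$ with $\zeta(v)=0$ there are $i,j\in[k]$, $i\ne j$, such that $v$ has no neighbor $u$ with $\zeta(u)=i$ and at most one neighbor $w$ with $\zeta(w)=j$. For a (proper) $k$-coloring $\sigma:V\to[k]$ of $G$, let $\hat\sigma:V\to\{0,1,\dots,k\}$ be the outcome of the following process: start with $\hat\sigma=\sigma$ and, while there is a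 vertex $v$ with $\hat\sigma(v)\ne0$ that is not stable under $\hat\sigma$, set $\hat\sigma(v)=0$ (the outcome does not depend on the order of the steps). A $k$-cover $\zeta$ of $G$ is *valid* if $\zeta=\hat\sigma$ for some $k$-coloring $\sigma$ of $G$. **Proposition.** There are a number $k_0$ and a sequence $(\varepsilon_k)_k$ with $\lim_{k\to\infty}\varepsilon_k=0$ such that for all integers $k\ge k_0$ and all real $d$ with $2k\ln k-\ln k-4\le d\le 2k\ln k$, w.h.p. every valid $k$-cover $\zeta$ of $G(n,m)$ has the following properties: 1. $|\zeta^{-1}(0)|\le nk^{-2/3}$; 2. for all $i\in[k]$, $\bigl||\zeta^{-1}(i)|-\frac nk\bigr|\le\varepsilon_k\frac nk$, i.e. $|\zeta^{-1}(i)|=(1+o_k(1))\frac nk$; 3. there are at most $\ln^9k$ indices $i\in[k]$ such that $\bigl||\zeta^{-1}(i)|-\frac nk\bigr|>\frac n{k\ln^3k}$. -/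

import Mathlib

open Filter Topology

namespace KCover

/-- `v` is stable under `ζ : V → {0, 1, …, k}` if `ζ v ≠ 0` and for every color `j ∈ [k]`
other than `ζ v` there are at least two neighbors of `v` that are mapped to `j`.
The colors `[k]` are the nonzero elements of `Fin (k + 1)`. -/
def IsStable {V : Type*} (G : SimpleGraph V) {k : ℕ} (ζ : V → Fin (k + 1)) (v : V) : Prop :=
  ζ v ≠ 0 ∧ ∀ j : Fin (k + 1), j ≠ 0 → j ≠ ζ v →
    ∃ u₁ u₂ : V, u₁ ≠ u₂ ∧ G.Adj v u₁ ∧ G.Adj v u₂ ∧ ζ u₁ = j ∧ ζ u₂ = j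

/-- `ζ` is a `k`-cover in `G`. -/
structure IsCover {V : Type*} (G : SimpleGraph V) {k : ℕ} (ζ : V → Fin (k + 1)) : Prop where
  /-- No edge joins two vertices of the same nonzero color. -/
  proper : ∀ u v : V, G.Adj u v → ¬(ζ u = ζ v ∧ ζ u ≠ 0)
  /-- Every vertex with a nonzero value is stable. -/
  stable : ∀ v : V, ζ v ≠ 0 → IsStable G ζ v
  /-- A vertex with value `0` misses some color `i` entirely and sees another color `j`
  at most once. -/
  zero : ∀ v : V, ζ v = 0 → ∃ i j : Fin (k + 1), i ≠ 0 ∧ j ≠ 0 ∧ i ≠ j ∧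
    (∀ u : V, G.Adj v u → ζ u ≠ i) ∧
    (∀ u w : V, G.Adj v u → G.Adj v w → ζ u = j → ζ w = j → u = w)

/-- One iteration of the whitening process: some vertex `v` with `ζ v ≠ 0` that is not stable
under `ζ` gets the new value `0`. -/
def WhiteningStep {V : Type*} [DecidableEq V] (G : SimpleGraph V) {k : ℕ}
    (ζ ζ' : V → Fin (k + 1)) : Prop :=
  ∃ v : V, ζ v ≠ 0 ∧ ¬ IsStable G ζ v ∧ ζ' = Function.update ζ v 0

/-- `ζ` is the outcome of the whitening process started from the `k`-coloring `σ`: it is reached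
from `σ` by whitening steps, and no further step is possible. -/
def IsWhitening {V : Type*} [DecidableEq V] (G : SimpleGraph V) {k : ℕ}
    (σ : G.Coloring (Fin k)) (ζ : V → Fin (k + 1)) : Prop :=
  Relation.ReflTransGen (WhiteningStep G) (fun v => (σ v).succ) ζ ∧
    ∀ v : V, ζ v ≠ 0 → IsStable G ζ v

/-- `ζ` is a valid `k`-cover of `G`. -/
def IsValidCover {V : Type*} [DecidableEq V] (G : SimpleGraph V) {k : ℕ}
    (ζ : V → Fin (k + 1)) : Prop :=
  IsCover G ζ ∧ ∃ σ : G.Coloring (Fin k), IsWhitening G σ ζ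

/-- The probability that `G(n,m)`, the uniformly random simple graph on `n` vertices with exactly
`m` edges, has the property `P`. (The value is `0` if `m > n(n-1)/2`, where no graph exists.) -/
noncomputable def gnmProb (n m : ℕ) (P : SimpleGraph (Fin n) → Prop) : ℝ :=
  ({G : SimpleGraph (Fin n) | G.edgeSet.ncard = m ∧ P G}.ncard : ℝ) /
    ({G : SimpleGraph (Fin n) | G.edgeSet.ncard = m}.ncard : ℝ)

/-- With `m = ⌈dn/2⌉`, the random graph `G(n,m)` has the property `P` with high probability. -/
def WHP (d : ℝ) (P : ∀ n : ℕ, SimpleGraph (Fin n) → Prop) : Prop :=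
  Tendsto (fun n : ℕ => gnmProb n ⌈d * (n : ℝ) / 2⌉₊ (P n)) atTop (𝓝 1)

/-- The size `|ζ⁻¹(i)|`. -/
noncomputable def classSize {n k : ℕ} (ζ : Fin n → Fin (k + 1)) (i : Fin (k + 1)) : ℕ :=
  (ζ ⁻¹' {i}).ncard

end KCover

/-! The proof is a first moment computation over all `k`-colorings `σ`. Put `L = ln k`, `c = n/k`,
and let `M` and `N` count the bichromatic pairs of `σ` and all pairs. A random graph is properly
colored by `σ` with probability at most `(M/N)^m`, and is then a uniform `m`-subset of the
bichromatic pairs. Replacing it by independent edges of density `p = m/M` costs a factor `M + 1`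
(`card_powersetCard_filter_le`). The sum of `(M/N)^m` over all `σ` is `O(exp(3c))` for fixed `k`;
this uses the lower bound on `d`. So planted events of probability `O(exp(-5c))` can be excluded for
all colorings at once (`one_sub_sum_le_gnmProb`, `sum_badColoring_le`). Colorings with `imbalance`
above `5/L` need no further event: their imbalance alone makes `(M/N)^m` smaller by `exp(-4c)`.

For a balanced `σ` the mean degree into a foreign class is about `pc ≈ 2L`. Let `U` be the set of
vertices with at most `L/100` neighbors in some foreign class; a Chernoff bound puts a vertex into
`U` with probability at most about `k^(-0.86)`. Placing `s ≈ 100c/L` such vertices anywhere would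
cost entropy about `L` each, which is too much. Inside at most `(s + a)/a` classes, with `a =
k^(-0.7) c`, it costs only about `0.7L` each (`subsetProb_manyLowDeg_le`). Hence the classes with at
least `a` vertices of `U` contain fewer than `s` of them together, and all other classes contribute
at most `ka = n k^(-0.7)`.

Whitening removes one vertex at a time, so if more than `y ≈ c/L` vertices outside `U` turned white,
some stage would have a set `Y` of exactly `y` of them. Each vertex of `Y` has more than `L/100`
neighbors in some class, all but at most one of them white, hence in `U` or `Y`: far too many edges
into so small a set. To keep the edges at `Y` independent of the target set, low degree is measured
there by edges avoiding `Y` only (`lowDeg`, `subsetProb_denseAround_le`). Every class therefore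
differs from `n/k` only by imbalance and by white vertices of these two kinds, and
`cover_properties` draws the three conclusions. -/

namespace KCover

/-! ### Binomial random subsets of a finite set -/

section BinomialSubset

variable {α : Type*} [DecidableEq α]

/-- The expectation of `f` over a random subset of `E` that contains every element independently
with probability `p`. -/
noncomputable def subsetAvg (p : ℝ) (E : Finset α) (f : Finset α → ℝ) : ℝ :=
  ∑ S ∈ E.powerset, p ^ S.card * (1 - p) ^ (E \ S).card * f S

open Classical in
/-- The probability that a random subset of `E`, containing every element independently
with probability `p`, has the property `Q`. -/
noncomputable def subsetProb (p : ℝ) (E : Finset α) (Q : Finset α → Prop) : ℝ :=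
  subsetAvg p E (fun S => if Q S then 1 else 0)

lemma subsetAvg_mono {p : ℝ} (h0 : 0 ≤ p) (h1 : p ≤ 1) {E : Finset α} {f g : Finset α → ℝ}
    (h : ∀ S ⊆ E, f S ≤ g S) : subsetAvg p E f ≤ subsetAvg p E g := by
  unfold subsetAvg
  have : 0 ≤ 1 - p := by linarith
  refine Finset.sum_le_sum fun S hS => ?_
  exact mul_le_mul_of_nonneg_left (h S (Finset.mem_powerset.1 hS)) (by positivity)

lemma subsetAvg_const_mul (p c : ℝ) (E : Finset α) (f : Finset α → ℝ) :
    subsetAvg p E (fun S => c * f S) = c * subsetAvg p E f := by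
  unfold subsetAvg
  rw [Finset.mul_sum]
  exact Finset.sum_congr rfl fun S _ => by ring

lemma subsetAvg_sum {ι : Type*} (p : ℝ) (E : Finset α) (I : Finset ι) (f : ι → Finset α → ℝ) :
    subsetAvg p E (fun S => ∑ i ∈ I, f i S) = ∑ i ∈ I, subsetAvg p E (f i) := by
  unfold subsetAvg
  rw [Finset.sum_comm]
  exact Finset.sum_congr rfl fun S _ => by rw [Finset.mul_sum]

lemma subsetAvg_prod (p : ℝ) (E : Finset α) (g : α → ℝ) :
    subsetAvg p E (fun S => ∏ e ∈ S, g e) = ∏ e ∈ E, (p * g e + (1 - p)) := by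
  unfold subsetAvg
  rw [Finset.prod_add]
  refine Finset.sum_congr rfl fun S _ => ?_
  rw [Finset.prod_mul_distrib, Finset.prod_const, Finset.prod_const]
  ring

lemma subsetAvg_one (p : ℝ) (E : Finset α) : subsetAvg p E (fun _ => 1) = 1 := by
  simpa using subsetAvg_prod p E (fun _ => 1)

/-- By independence each element of `E ∩ F` contributes a factor `1 + p(t - 1)`. This generating
function is the source of both Chernoff bounds below, with `t < 1` for lower tails and `t > 1` for
upper tails. -/
lemma subsetAvg_pow_card_inter (p t : ℝ) (E F : Finset α) :
    subsetAvg p E (fun S => t ^ (S ∩ F).card) = (1 + p * (t - 1)) ^ (E ∩ F).card := by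
  have h := subsetAvg_prod p E (fun e => if e ∈ F then t else 1)
  have h2 : ∀ S : Finset α, (∏ e ∈ S, if e ∈ F then t else 1) = t ^ (S ∩ F).card := by
    intro S
    rw [← Finset.prod_filter, Finset.prod_const, Finset.filter_mem_eq_inter]
  simp only [h2] at h
  rw [h, ← Finset.filter_mem_eq_inter, ← Finset.prod_const, Finset.prod_filter]
  refine Finset.prod_congr rfl fun e _ => ?_
  split_ifs <;> ring

lemma subsetProb_le_avg {p : ℝ} (h0 : 0 ≤ p) (h1 : p ≤ 1) {E : Finset α}
    {Q : Finset α → Prop} {f : Finset α → ℝ} (hf : ∀ S ⊆ E, 0 ≤ f S)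
    (h : ∀ S ⊆ E, Q S → 1 ≤ f S) : subsetProb p E Q ≤ subsetAvg p E f := by
  classical
  refine subsetAvg_mono h0 h1 fun S hS => ?_
  split_ifs with hQ
  · exact h S hS hQ
  · exact hf S hS

lemma subsetProb_le_one {p : ℝ} (h0 : 0 ≤ p) (h1 : p ≤ 1) (E : Finset α)
    (Q : Finset α → Prop) : subsetProb p E Q ≤ 1 := by
  rw [← subsetAvg_one p E]
  exact subsetProb_le_avg h0 h1 (fun _ _ => zero_le_one) (fun _ _ _ => le_rfl)

lemma subsetProb_mono {p : ℝ} (h0 : 0 ≤ p) (h1 : p ≤ 1) {E : Finset α}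
    {Q R : Finset α → Prop} (h : ∀ S ⊆ E, Q S → R S) : subsetProb p E Q ≤ subsetProb p E R := by
  classical
  refine subsetAvg_mono h0 h1 fun S hS => ?_
  have := h S hS
  split_ifs <;> first | tauto | norm_num

lemma subsetProb_exists_le {p : ℝ} (h0 : 0 ≤ p) (h1 : p ≤ 1) {ι : Type*} (E : Finset α)
    (I : Finset ι) (Q : ι → Finset α → Prop) :
    subsetProb p E (fun S => ∃ i ∈ I, Q i S) ≤ ∑ i ∈ I, subsetProb p E (Q i) := by
  classical
  unfold subsetProb
  rw [← subsetAvg_sum]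
  refine subsetAvg_mono h0 h1 fun S _ => ?_
  split_ifs with h
  · obtain ⟨i, hi, hQ⟩ := h
    have := Finset.single_le_sum (f := fun i => if Q i S then (1 : ℝ) else 0)
      (fun j _ => by positivity) hi
    simpa [hQ] using this
  · exact Finset.sum_nonneg fun j _ => by positivity

lemma subsetProb_or_le {p : ℝ} (h0 : 0 ≤ p) (h1 : p ≤ 1) (E : Finset α)
    (Q R : Finset α → Prop) :
    subsetProb p E (fun S => Q S ∨ R S) ≤ subsetProb p E Q + subsetProb p E R := by
  have h := subsetProb_exists_le h0 h1 E (Finset.univ : Finset Bool) (fun b => if b then Q else R)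
  simpa [or_comm, add_comm] using h

/-- Fubini for a partition of the ground set into two parts. -/
lemma subsetAvg_eq_avg_avg (p : ℝ) (E : Finset α) (P : α → Prop) [DecidablePred P]
    (f : Finset α → ℝ) :
    subsetAvg p E f = subsetAvg p (E.filter P) (fun S₁ =>
      subsetAvg p (E.filter (fun e => ¬ P e)) (fun S₂ => f (S₁ ∪ S₂))) := by
  unfold subsetAvg
  simp only [Finset.mul_sum]
  rw [← Finset.sum_product']
  refine Finset.sum_nbij' (fun S => (S.filter P, S.filter (fun e => ¬ P e)))
    (fun T => T.1 ∪ T.2) ?_ ?_ ?_ ?_ ?_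
  · intro S hS
    simp only [Finset.mem_product, Finset.mem_powerset] at hS ⊢
    exact ⟨Finset.filter_subset_filter _ hS, Finset.filter_subset_filter _ hS⟩
  · intro T hT
    simp only [Finset.mem_product, Finset.mem_powerset] at hT ⊢
    exact Finset.union_subset (hT.1.trans (Finset.filter_subset _ _))
      (hT.2.trans (Finset.filter_subset _ _))
  · intro S _
    exact Finset.filter_union_filter_not_eq _ _
  · rintro ⟨T₁, T₂⟩ hT
    simp only [Finset.mem_product, Finset.mem_powerset] at hT
    have h1 : ∀ e ∈ T₁, P e := fun e he => (Finset.mem_filter.1 (hT.1 he)).2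
    have h2 : ∀ e ∈ T₂, ¬ P e := fun e he => (Finset.mem_filter.1 (hT.2 he)).2
    ext e <;> simp only [Finset.mem_filter, Finset.mem_union]
    · constructor
      · rintro ⟨h | h, h'⟩
        · exact h
        · exact absurd h' (h2 e h)
      · exact fun h => ⟨Or.inl h, h1 e h⟩
    · constructor
      · rintro ⟨h | h, h'⟩
        · exact absurd (h1 e h) h'
        · exact h
      · exact fun h => ⟨Or.inr h, h2 e h⟩
  · intro S hS
    have hS1 : (S.filter P).card + (S.filter (fun e => ¬ P e)).card = S.card :=
      Finset.card_filter_add_card_filter_not _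
    have e1 : E.filter P \ S.filter P = (E \ S).filter P := by
      ext e; simp only [Finset.mem_sdiff, Finset.mem_filter]; tauto
    have e2 : E.filter (fun e => ¬ P e) \ S.filter (fun e => ¬ P e)
        = (E \ S).filter (fun e => ¬ P e) := by
      ext e; simp only [Finset.mem_sdiff, Finset.mem_filter]; tauto
    have hS2 : ((E \ S).filter P).card + ((E \ S).filter (fun e => ¬ P e)).card = (E \ S).card :=
      Finset.card_filter_add_card_filter_not _
    simp only [e1, e2, Finset.filter_union_filter_not_eq]
    rw [← hS1, ← hS2, pow_add, pow_add]
    ring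

/-- Conditioning: the part `S₁` satisfying `P` is exposed first, and a bound uniform in `S₁`
survives averaging. -/
lemma subsetProb_le_of_forall_fiber {p B : ℝ} (h0 : 0 ≤ p) (h1 : p ≤ 1) (E : Finset α)
    (P : α → Prop) [DecidablePred P] (Q : Finset α → Prop)
    (h : ∀ S₁ ⊆ E.filter P,
      subsetProb p (E.filter (fun e => ¬ P e)) (fun S₂ => Q (S₁ ∪ S₂)) ≤ B) :
    subsetProb p E Q ≤ B := by
  classical
  unfold subsetProb
  rw [subsetAvg_eq_avg_avg p E P]
  calc _ ≤ subsetAvg p (E.filter P) (fun _ => B * 1) :=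
        subsetAvg_mono h0 h1 fun S hS => (h S hS).trans_eq (mul_one B).symm
    _ = B := by rw [subsetAvg_const_mul, subsetAvg_one, mul_one]

end BinomialSubset

/-! ### Comparison of uniform and binomial random subsets -/

/-- The quotient of the two factorials is a product of `|j - m|` factors, all at least `m` if `j ≥
m` and all at most `m` otherwise. -/
lemma factorial_mul_pow_le (m j : ℕ) :
    m.factorial * m ^ j ≤ j.factorial * m ^ m := by
  rcases le_total m j with h | h
  · calc m.factorial * m ^ j = m.factorial * m ^ (j - m) * m ^ m := by
          rw [mul_assoc, ← pow_add, Nat.sub_add_cancel h]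
      _ ≤ _ := Nat.mul_le_mul_right _ (Nat.factorial_mul_pow_sub_le_factorial h)
  · obtain ⟨i, rfl⟩ := Nat.exists_eq_add_of_le h
    have h1 : (j + i).factorial ≤ j.factorial * (j + i) ^ i := by
      rw [← Nat.factorial_mul_ascFactorial]
      refine Nat.mul_le_mul_left _ ?_
      exact Nat.ascFactorial_le_pow_add j i
    calc (j + i).factorial * (j + i) ^ j ≤ j.factorial * (j + i) ^ i * (j + i) ^ j :=
          Nat.mul_le_mul_right _ h1
      _ = _ := by rw [mul_assoc, ← pow_add, Nat.add_comm i j]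

/-- The mode of the binomial distribution with mean `m` is `m`. -/
lemma choose_mul_pow_le_mode {M m j : ℕ} (hm : m ≤ M) (hj : j ≤ M) :
    M.choose j * (m ^ j * (M - m) ^ (M - j)) ≤ M.choose m * (m ^ m * (M - m) ^ (M - m)) := by
  have h1 := factorial_mul_pow_le m j
  have h2 := factorial_mul_pow_le (M - m) (M - j)
  have c1 := Nat.choose_mul_factorial_mul_factorial hm
  have c2 := Nat.choose_mul_factorial_mul_factorial hj
  have hpos : 0 < m.factorial * (M - m).factorial * (j.factorial * (M - j).factorial) := by
    positivity
  refine Nat.le_of_mul_le_mul_left ?_ hpos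
  calc m.factorial * (M - m).factorial * (j.factorial * (M - j).factorial) *
        (M.choose j * (m ^ j * (M - m) ^ (M - j)))
      = (M.choose j * j.factorial * (M - j).factorial) *
        ((m.factorial * m ^ j) * ((M - m).factorial * (M - m) ^ (M - j))) := by ring
    _ ≤ (M.choose j * j.factorial * (M - j).factorial) *
        ((j.factorial * m ^ m) * ((M - j).factorial * (M - m) ^ (M - m))) :=
        Nat.mul_le_mul_left _ (Nat.mul_le_mul h1 h2)
    _ = (M.choose m * m.factorial * (M - m).factorial) *
        ((j.factorial * m ^ m) * ((M - j).factorial * (M - m) ^ (M - m))) := by rw [c1, c2]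
    _ = _ := by ring

/-- The `M + 1` binomial probabilities sum to `1`, so the largest is at least `1/(M + 1)`. -/
lemma one_le_card_mul_choose_mul_pow {M m : ℕ} (hm : m ≤ M) (hM : 0 < M) :
    1 ≤ ((M : ℝ) + 1) * (M.choose m * ((m / M : ℝ) ^ m * (1 - m / M : ℝ) ^ (M - m))) := by
  have hM' : (0 : ℝ) < M := by exact_mod_cast hM
  have e : (1 - m / M : ℝ) = ((M - m : ℕ) : ℝ) / M := by
    rw [Nat.cast_sub hm]; field_simp
  have key : ∀ j ≤ M, (m / M : ℝ) ^ j * (1 - m / M : ℝ) ^ (M - j) * M.choose j ≤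
      M.choose m * ((m / M : ℝ) ^ m * (1 - m / M : ℝ) ^ (M - m)) := by
    intro j hj
    have h := choose_mul_pow_le_mode hm hj
    have h' : ((M.choose j : ℝ) * ((m : ℝ) ^ j * ((M - m : ℕ) : ℝ) ^ (M - j))) ≤
        M.choose m * ((m : ℝ) ^ m * ((M - m : ℕ) : ℝ) ^ (M - m)) := by exact_mod_cast h
    rw [e, div_pow, div_pow, div_pow, div_pow, div_mul_div_comm, div_mul_div_comm, ← pow_add,
      ← pow_add, Nat.add_sub_cancel' hj, Nat.add_sub_cancel' hm, div_mul_eq_mul_div,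
      mul_div_assoc']
    exact div_le_div_of_nonneg_right (by linarith) (by positivity)
  have hsum : (1 : ℝ) = ∑ j ∈ Finset.range (M + 1),
      (m / M : ℝ) ^ j * (1 - m / M : ℝ) ^ (M - j) * M.choose j := by
    rw [← add_pow]; simp
  calc (1 : ℝ) = _ := hsum
    _ ≤ ∑ j ∈ Finset.range (M + 1),
        (M.choose m : ℝ) * ((m / M : ℝ) ^ m * (1 - m / M : ℝ) ^ (M - m)) :=
        Finset.sum_le_sum fun j hj => key j (by simpa [Nat.lt_succ_iff] using hj)
    _ = _ := by rw [Finset.sum_const, Finset.card_range, nsmul_eq_mul]; push_cast; ring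

-- Conditioned on having `m` elements, the binomial subset is uniform, and it has `m` elements with
-- probability at least `1/(|E| + 1)`. The lost polynomial factor is harmless against exponentially
-- small probabilities.
open Classical in
lemma card_powersetCard_filter_le {α : Type*} [DecidableEq α] (E : Finset α) (m : ℕ)
    (hm : m ≤ E.card) (hE : 0 < E.card) (Q : Finset α → Prop) :
    (((E.powersetCard m).filter Q).card : ℝ) ≤
      (E.card.choose m * (E.card + 1 : ℝ)) * subsetProb (m / E.card) E Q := by
  have hm' : (m : ℝ) ≤ E.card := by exact_mod_cast hm
  have hE' : (0 : ℝ) < E.card := by exact_mod_cast hE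
  set p : ℝ := m / E.card with hp
  have h0 : 0 ≤ p := by positivity
  have h1 : 0 ≤ 1 - p := by
    have : p ≤ 1 := (div_le_one hE').2 hm'
    linarith
  set w : ℝ := p ^ m * (1 - p) ^ (E.card - m) with hw
  have hw0 : 0 ≤ w := by positivity
  have h2 : ((E.powersetCard m).filter Q).card * w ≤ subsetProb p E Q := by
    calc ((E.powersetCard m).filter Q).card * w
        = ∑ S ∈ (E.powersetCard m).filter Q, p ^ S.card * (1 - p) ^ (E \ S).card *
          (if Q S then 1 else 0) := by
          rw [← nsmul_eq_mul, ← Finset.sum_const]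
          refine Finset.sum_congr rfl fun S hS => ?_
          rw [Finset.mem_filter, Finset.mem_powersetCard] at hS
          rw [if_pos hS.2, Finset.card_sdiff_of_subset hS.1.1, hS.1.2, mul_one]
      _ ≤ _ := by
          refine Finset.sum_le_sum_of_subset_of_nonneg ?_ ?_
          · intro S hS
            rw [Finset.mem_filter, Finset.mem_powersetCard] at hS
            exact Finset.mem_powerset.2 hS.1.1
          · intro S _ _
            positivity
  have h3 := one_le_card_mul_choose_mul_pow hm hE
  calc (((E.powersetCard m).filter Q).card : ℝ)
      ≤ ((E.powersetCard m).filter Q).card * (((E.card : ℝ) + 1) * (E.card.choose m * w)) :=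
        le_mul_of_one_le_right (by positivity) h3
    _ = (E.card.choose m * (E.card + 1 : ℝ)) * (((E.powersetCard m).filter Q).card * w) := by ring
    _ ≤ _ := mul_le_mul_of_nonneg_left h2 (by positivity)

/-- Sampling without replacement hits a subset less often than sampling with replacement: `(M -
i)/(N - i) ≤ M/N`. -/
lemma choose_mul_pow_le_choose_mul_pow {M N : ℕ} (h : M ≤ N) (m : ℕ) :
    M.choose m * N ^ m ≤ N.choose m * M ^ m := by
  have h1 : M.descFactorial m * N ^ m ≤ N.descFactorial m * M ^ m := by
    induction m with
    | zero => simp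
    | succ m ih =>
      rw [Nat.descFactorial_succ, Nat.descFactorial_succ, pow_succ, pow_succ]
      have : (M - m) * N ≤ (N - m) * M := by
        rw [Nat.sub_mul, Nat.sub_mul, Nat.mul_comm N M]
        exact Nat.sub_le_sub_left (Nat.mul_le_mul_left _ h) _
      calc (M - m) * M.descFactorial m * (N ^ m * N)
          = (M.descFactorial m * N ^ m) * ((M - m) * N) := by ring
        _ ≤ (N.descFactorial m * M ^ m) * ((N - m) * M) := Nat.mul_le_mul ih this
        _ = _ := by ring
  rw [Nat.descFactorial_eq_factorial_mul_choose, Nat.descFactorial_eq_factorial_mul_choose,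
    mul_assoc, mul_assoc] at h1
  exact Nat.le_of_mul_le_mul_left h1 (Nat.factorial_pos m)

lemma choose_le_exp_mul_div_pow (n s : ℕ) (hs : 0 < s) :
    (n.choose s : ℝ) ≤ (Real.exp 1 * (n / s)) ^ s := by
  have h1 : (n.choose s : ℝ) ≤ (n : ℝ) ^ s / s.factorial := Nat.choose_le_pow_div s n
  have h2 : (s : ℝ) ^ s / s.factorial ≤ Real.exp s :=
    Real.pow_div_factorial_le_exp s (Nat.cast_nonneg s) s
  have hs' : (0 : ℝ) < s := by exact_mod_cast hs
  have hf : (0 : ℝ) < s.factorial := by exact_mod_cast Nat.factorial_pos s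
  calc (n.choose s : ℝ) ≤ (n : ℝ) ^ s / s.factorial := h1
    _ = ((s : ℝ) ^ s / s.factorial) * (n / s) ^ s := by
        rw [div_pow]; field_simp
    _ ≤ Real.exp s * (n / s) ^ s := by gcongr
    _ = _ := by rw [mul_pow, ← Real.exp_nat_mul, mul_one]

/-! ### Graphs with a prescribed coloring as sets of edges -/

section EdgeSets

variable {V : Type*} [Fintype V]

/-- The set of edges of a graph on a finite vertex set. -/
noncomputable def edges (G : SimpleGraph V) : Finset (Sym2 V) := G.edgeSet.toFinite.toFinset

lemma mem_edges {G : SimpleGraph V} {e : Sym2 V} : e ∈ edges G ↔ e ∈ G.edgeSet := by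
  simp [edges]

lemma card_edges (G : SimpleGraph V) : (edges G).card = G.edgeSet.ncard :=
  (Set.ncard_eq_toFinset_card _ _).symm

lemma edges_injective : Function.Injective (edges : SimpleGraph V → Finset (Sym2 V)) := by
  intro G H h
  rw [← SimpleGraph.edgeSet_inj]
  ext e
  rw [← mem_edges, ← mem_edges, h]

/-- The pairs of vertices that are not monochromatic under `σ`. -/
def crossPairs {κ : Type*} [DecidableEq κ] (σ : V → κ) : Finset (Sym2 V) :=
  Finset.univ.filter fun e => ¬ (e.map σ).IsDiag

lemma mem_crossPairs {κ : Type*} [DecidableEq κ] {σ : V → κ} {u v : V} :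
    s(u, v) ∈ crossPairs σ ↔ σ u ≠ σ v := by
  simp [crossPairs]

lemma edges_subset_crossPairs {κ : Type*} [DecidableEq κ] {σ : V → κ} {G : SimpleGraph V}
    (h : ∀ u v, G.Adj u v → σ u ≠ σ v) : edges G ⊆ crossPairs σ := by
  intro e
  induction e with
  | h u v =>
    intro he
    exact mem_crossPairs.2 (h u v (by simpa [mem_edges] using he))

/-- The vertices of color `j`. -/
def colorClass {κ : Type*} [DecidableEq κ] (σ : V → κ) (j : κ) : Finset V :=
  Finset.univ.filter fun v => σ v = j

@[simp] lemma mem_colorClass {κ : Type*} [DecidableEq κ] {σ : V → κ} {j : κ} {v : V} :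
    v ∈ colorClass σ j ↔ σ v = j := by
  simp [colorClass]

lemma sum_card_colorClass {κ : Type*} [DecidableEq κ] [Fintype κ] (σ : V → κ) :
    ∑ j, (colorClass σ j).card = Fintype.card V := by
  rw [← Finset.card_univ, Finset.card_eq_sum_card_fiberwise (f := σ) (t := Finset.univ)
    (fun _ _ => Finset.mem_univ _)]
  rfl

variable [DecidableEq V]

lemma crossPairs_subset {κ : Type*} [DecidableEq κ] (σ : V → κ) :
    crossPairs σ ⊆ crossPairs (id : V → V) := by
  intro e
  induction e with
  | h u v =>
    intro he
    rw [mem_crossPairs] at he ⊢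
    exact fun h => he (congrArg σ h)

/-- Double count of ordered pairs: bichromatic pairs occur twice, and the ordered monochromatic
pairs, diagonal included, give the squares. -/
lemma two_mul_card_crossPairs {κ : Type*} [DecidableEq κ] [Fintype κ] (σ : V → κ) :
    2 * (crossPairs σ).card + ∑ j, (colorClass σ j).card ^ 2 = Fintype.card V ^ 2 := by
  have h1 : (Finset.univ.filter fun q : V × V => σ q.1 ≠ σ q.2).card
      = 2 * (crossPairs σ).card := by
    rw [Finset.card_eq_sum_card_fiberwise (f := fun q : V × V => s(q.1, q.2))
      (t := crossPairs σ)]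
    · rw [Finset.sum_const_nat (m := 2), Nat.mul_comm]
      intro e
      induction e with
      | h u v =>
        intro he
        rw [mem_crossPairs] at he
        have huv : u ≠ v := fun h => he (congrArg σ h)
        have : ((Finset.univ.filter fun q : V × V => σ q.1 ≠ σ q.2).filter
            fun q => s(q.1, q.2) = s(u, v)) = {(u, v), (v, u)} := by
          ext ⟨a, b⟩
          simp only [Finset.mem_filter, Finset.mem_univ, true_and, Sym2.eq_iff,
            Finset.mem_insert, Finset.mem_singleton, Prod.mk.injEq]
          constructor
          · exact fun h => h.2
          · rintro (⟨rfl, rfl⟩ | ⟨rfl, rfl⟩)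
            · exact ⟨he, Or.inl ⟨rfl, rfl⟩⟩
            · exact ⟨he.symm, Or.inr ⟨rfl, rfl⟩⟩
        rw [this, Finset.card_pair]
        exact fun h => huv (Prod.mk.inj h).1
    · rintro ⟨u, v⟩ h
      simpa [mem_crossPairs] using h
  have h2 : (Finset.univ.filter fun q : V × V => σ q.1 = σ q.2).card
      = ∑ j, (colorClass σ j).card ^ 2 := by
    rw [Finset.card_eq_sum_card_fiberwise (f := fun q : V × V => σ q.1)
      (t := Finset.univ) (fun _ _ => Finset.mem_univ _)]
    refine Finset.sum_congr rfl fun j _ => ?_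
    rw [sq, ← Finset.card_product]
    congr 1
    ext ⟨a, b⟩
    simp only [Finset.mem_filter, Finset.mem_univ, true_and, Finset.mem_product, mem_colorClass]
    constructor
    · rintro ⟨h, rfl⟩
      exact ⟨rfl, h.symm⟩
    · rintro ⟨rfl, h⟩
      exact ⟨h.symm, rfl⟩
  rw [← h1, ← h2, add_comm, Finset.card_filter_add_card_filter_not, Finset.card_univ,
    Fintype.card_prod, sq]

lemma choose_le_ncard_graphs (m : ℕ) :
    (crossPairs (id : V → V)).card.choose m ≤
      {G : SimpleGraph V | G.edgeSet.ncard = m}.ncard := by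
  classical
  rw [← Finset.card_powersetCard, ← Set.ncard_coe_finset]
  refine Set.ncard_le_ncard_of_injOn (fun S => SimpleGraph.fromEdgeSet (S : Set (Sym2 V)))
    ?_ ?_ (Set.toFinite _)
  · intro S hS
    have hS' := Finset.mem_powersetCard.1 hS
    have : (S : Set (Sym2 V)) \ {e | e.IsDiag} = S := by
      ext e
      simp only [Set.mem_sdiff, Finset.mem_coe, Set.mem_ofPred_eq, and_iff_left_iff_imp]
      intro he
      simpa [crossPairs] using hS'.1 he
    simp only [Set.mem_ofPred_eq, SimpleGraph.edgeSet_fromEdgeSet]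
    change ((S : Set (Sym2 V)) \ {e | e.IsDiag}).ncard = m
    rw [this, Set.ncard_coe_finset, hS'.2]
  · intro S hS T hT h
    have key : ∀ S : Finset (Sym2 V), S ∈ (crossPairs (id : V → V)).powersetCard m →
        (SimpleGraph.fromEdgeSet (S : Set (Sym2 V))).edgeSet = S := by
      intro S hS
      have hS' := Finset.mem_powersetCard.1 hS
      rw [SimpleGraph.edgeSet_fromEdgeSet]
      ext e
      simp only [Set.mem_sdiff, Finset.mem_coe, and_iff_left_iff_imp]
      intro he
      simpa [crossPairs] using hS'.1 he
    have h' := congrArg SimpleGraph.edgeSet h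
    simp only at h'
    rw [key S hS, key T hT] at h'
    exact_mod_cast h'

lemma ncard_graphs_pos {m : ℕ} (hm : m ≤ (crossPairs (id : V → V)).card) :
    0 < {G : SimpleGraph V | G.edgeSet.ncard = m}.ncard :=
  (Nat.choose_pos hm).trans_le (choose_le_ncard_graphs m)

lemma ncard_graphs_colored_le {κ : Type*} [DecidableEq κ] (σ : V → κ) {m : ℕ} (hm : 0 < m)
    (Q : Finset (Sym2 V) → Prop) {β : ℝ} (hβ : 0 ≤ β)
    (h : m ≤ (crossPairs σ).card → subsetProb (m / (crossPairs σ).card) (crossPairs σ) Q ≤ β) :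
    ({G : SimpleGraph V | G.edgeSet.ncard = m ∧ (∀ u v, G.Adj u v → σ u ≠ σ v) ∧
      Q (edges G)}.ncard : ℝ) ≤ (crossPairs σ).card.choose m * ((crossPairs σ).card + 1) * β := by
  classical
  have h1 : {G : SimpleGraph V | G.edgeSet.ncard = m ∧ (∀ u v, G.Adj u v → σ u ≠ σ v) ∧
      Q (edges G)}.ncard ≤ (((crossPairs σ).powersetCard m).filter Q).card := by
    rw [← Set.ncard_coe_finset]
    refine Set.ncard_le_ncard_of_injOn edges ?_ edges_injective.injOn (Set.toFinite _)
    rintro G ⟨h1, h2, h3⟩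
    simp only [Finset.coe_filter, Finset.mem_powersetCard, Set.mem_ofPred_eq]
    exact ⟨⟨edges_subset_crossPairs h2, (card_edges G).trans h1⟩, h3⟩
  have h1' : ({G : SimpleGraph V | G.edgeSet.ncard = m ∧ (∀ u v, G.Adj u v → σ u ≠ σ v) ∧
      Q (edges G)}.ncard : ℝ) ≤ ((((crossPairs σ).powersetCard m).filter Q).card : ℝ) := by
    exact_mod_cast h1
  refine h1'.trans ?_
  by_cases hc : m ≤ (crossPairs σ).card
  · convert (card_powersetCard_filter_le (crossPairs σ) m hc (hm.trans_le hc) Q).trans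
      (mul_le_mul_of_nonneg_left (h hc) (by positivity)) using 1
  · rw [Finset.powersetCard_eq_empty.2 (not_le.1 hc)]
    simp only [Finset.filter_empty, Finset.card_empty, Nat.cast_zero]
    positivity

end EdgeSets

/-! ### First moment over planted colorings -/

lemma gnmProb_le_one (n m : ℕ) (P : SimpleGraph (Fin n) → Prop) : gnmProb n m P ≤ 1 := by
  refine div_le_one_of_le₀ ?_ (by positivity)
  have h : {G : SimpleGraph (Fin n) | G.edgeSet.ncard = m ∧ P G}.ncard ≤
      {G : SimpleGraph (Fin n) | G.edgeSet.ncard = m}.ncard :=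
    Set.ncard_le_ncard (fun G hG => And.left hG) (Set.toFinite _)
  exact_mod_cast h

/-- First moment bound over all colorings, in terms of the random graph with a planted coloring. -/
lemma one_sub_sum_le_gnmProb {n k m : ℕ} (hm : 0 < m)
    (hmN : m ≤ (crossPairs (id : Fin n → Fin n)).card) (P : SimpleGraph (Fin n) → Prop)
    (Bad : (Fin n → Fin k) → Finset (Sym2 (Fin n)) → Prop) (β : (Fin n → Fin k) → ℝ)
    (hβ0 : ∀ σ, 0 ≤ β σ)
    (hP : ∀ G, ¬ P G → ∃ σ : Fin n → Fin k, (∀ u v, G.Adj u v → σ u ≠ σ v) ∧ Bad σ (edges G))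
    (hβ : ∀ σ, m ≤ (crossPairs σ).card →
      subsetProb (m / (crossPairs σ).card) (crossPairs σ) (Bad σ) ≤ β σ) :
    1 - ∑ σ : Fin n → Fin k, ((crossPairs σ).card / (crossPairs (id : Fin n → Fin n)).card : ℝ) ^ m
      * ((crossPairs σ).card + 1) * β σ ≤ gnmProb n m P := by
  classical
  set N := (crossPairs (id : Fin n → Fin n)).card with hN
  set T := {G : SimpleGraph (Fin n) | G.edgeSet.ncard = m} with hT
  have hN0 : (0 : ℝ) < N := by exact_mod_cast hm.trans_le hmN
  have hTpos : (0 : ℝ) < T.ncard := by exact_mod_cast ncard_graphs_pos hmN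
  have hTN : (N.choose m : ℝ) ≤ T.ncard := by exact_mod_cast choose_le_ncard_graphs m
  have hNpos : (0 : ℝ) < N.choose m := by exact_mod_cast Nat.choose_pos hmN
  set B : (Fin n → Fin k) → Set (SimpleGraph (Fin n)) := fun σ =>
    {G | G.edgeSet.ncard = m ∧ (∀ u v, G.Adj u v → σ u ≠ σ v) ∧ Bad σ (edges G)} with hB
  have hcover : T ⊆ {G | G.edgeSet.ncard = m ∧ P G} ∪ ⋃ σ, B σ := by
    intro G hG
    by_cases h : P G
    · exact Or.inl ⟨hG, h⟩
    · obtain ⟨σ, h1, h2⟩ := hP G h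
      exact Or.inr (Set.mem_iUnion.2 ⟨σ, hG, h1, h2⟩)
  have hcard : T.ncard ≤ {G : SimpleGraph (Fin n) | G.edgeSet.ncard = m ∧ P G}.ncard
      + ∑ σ, (B σ).ncard := by
    refine (Set.ncard_le_ncard hcover (Set.toFinite _)).trans ((Set.ncard_union_le _ _).trans ?_)
    gcongr
    have := Finset.set_ncard_biUnion_le (Finset.univ : Finset (Fin n → Fin k)) B
    simpa using this
  have hcard' : (T.ncard : ℝ) ≤ {G : SimpleGraph (Fin n) | G.edgeSet.ncard = m ∧ P G}.ncard
      + ∑ σ, ((B σ).ncard : ℝ) := by exact_mod_cast hcard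
  have hBσ : ∀ σ, ((B σ).ncard : ℝ) / T.ncard ≤
      ((crossPairs σ).card / N : ℝ) ^ m * ((crossPairs σ).card + 1) * β σ := by
    intro σ
    have h1 := ncard_graphs_colored_le σ hm (Bad σ) (hβ0 σ) (hβ σ)
    have h2 : ((crossPairs σ).card.choose m * N ^ m : ℝ) ≤ N.choose m * (crossPairs σ).card ^ m := by
      exact_mod_cast choose_mul_pow_le_choose_mul_pow (Finset.card_le_card (crossPairs_subset σ)) m
    have h3 : ((crossPairs σ).card.choose m : ℝ) / N.choose m ≤ ((crossPairs σ).card / N : ℝ) ^ m := by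
      rw [div_pow, div_le_div_iff₀ hNpos (by positivity)]
      linarith
    calc ((B σ).ncard : ℝ) / T.ncard ≤ ((B σ).ncard : ℝ) / N.choose m := by gcongr
      _ ≤ ((crossPairs σ).card.choose m * ((crossPairs σ).card + 1) * β σ) / N.choose m := by
          gcongr
      _ = ((crossPairs σ).card.choose m / N.choose m) * (((crossPairs σ).card + 1) * β σ) := by ring
      _ ≤ ((crossPairs σ).card / N : ℝ) ^ m * (((crossPairs σ).card + 1) * β σ) := by
          have := hβ0 σ
          gcongr
      _ = _ := by ring
  have hfin : (1 : ℝ) ≤ gnmProb n m P + ∑ σ, ((B σ).ncard : ℝ) / T.ncard := by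
    rw [← Finset.sum_div]
    unfold gnmProb
    rw [← add_div, le_div_iff₀ hTpos, one_mul]
    exact hcard'
  have := Finset.sum_le_sum fun σ (_ : σ ∈ (Finset.univ : Finset (Fin n → Fin k))) => hBσ σ
  linarith

/-! ### Degrees into sets of vertices -/

section Degrees

variable {V : Type*} [Fintype V] [DecidableEq V]

/-- The number of vertices `u ∈ B` such that `{v, u}` belongs to the edge set `S`. -/
def edgeDeg (S : Finset (Sym2 V)) (v : V) (B : Finset V) : ℕ := (B.filter fun u => s(v, u) ∈ S).card

omit [Fintype V] in
lemma edgeDeg_mono {S : Finset (Sym2 V)} {v : V} {B C : Finset V} (h : B ⊆ C) :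
    edgeDeg S v B ≤ edgeDeg S v C :=
  Finset.card_le_card (Finset.filter_subset_filter _ h)

omit [Fintype V] in
lemma edgeDeg_le_add {S : Finset (Sym2 V)} {v : V} {B C D : Finset V} (h : B ⊆ C ∪ D) :
    edgeDeg S v B ≤ edgeDeg S v C + edgeDeg S v D := by
  refine (edgeDeg_mono h).trans ?_
  unfold edgeDeg
  rw [Finset.filter_union]
  exact Finset.card_union_le _ _

omit [Fintype V] in
lemma edgeDeg_congr {S T : Finset (Sym2 V)} {v : V} {B : Finset V}
    (h : ∀ u ∈ B, s(v, u) ∈ S ↔ s(v, u) ∈ T) : edgeDeg S v B = edgeDeg T v B := by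
  unfold edgeDeg
  rw [Finset.filter_congr h]

/-- The pairs that join some `v ∈ Z` to an element of `B v`. -/
def starPairs (Z : Finset V) (B : V → Finset V) : Finset (Sym2 V) :=
  (Z.sigma B).image fun q => s(q.1, q.2)

omit [Fintype V] in
lemma sum_edgeDeg (S : Finset (Sym2 V)) (Z : Finset V) (B : V → Finset V) :
    ∑ v ∈ Z, edgeDeg S v (B v) = ((Z.sigma B).filter fun q => s(q.1, q.2) ∈ S).card := by
  have : (Z.sigma B).filter (fun q => s(q.1, q.2) ∈ S)
      = Z.sigma (fun v => (B v).filter fun u => s(v, u) ∈ S) := by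
    ext ⟨v, u⟩
    simp [and_assoc]
  rw [this, Finset.card_sigma]
  rfl

omit [Fintype V] in
lemma image_filter_sigma (S : Finset (Sym2 V)) (Z : Finset V) (B : V → Finset V) :
    ((Z.sigma B).filter fun q => s(q.1, q.2) ∈ S).image (fun q => s(q.1, q.2))
      = S ∩ starPairs Z B := by
  ext e
  simp only [starPairs, Finset.mem_image, Finset.mem_filter, Finset.mem_inter]
  constructor
  · rintro ⟨q, ⟨h1, h2⟩, rfl⟩
    exact ⟨h2, q, h1, rfl⟩
  · rintro ⟨h2, q, h1, rfl⟩
    exact ⟨q, ⟨h1, h2⟩, rfl⟩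

omit [Fintype V] in
lemma card_inter_starPairs_le (S : Finset (Sym2 V)) (Z : Finset V) (B : V → Finset V) :
    (S ∩ starPairs Z B).card ≤ ∑ v ∈ Z, edgeDeg S v (B v) := by
  rw [sum_edgeDeg, ← image_filter_sigma]
  exact Finset.card_image_le

-- An edge with both ends in `Z` may be counted from either end, whence the factor `2`.
omit [Fintype V] in
lemma sum_edgeDeg_le (S : Finset (Sym2 V)) (Z : Finset V) (B : V → Finset V) :
    ∑ v ∈ Z, edgeDeg S v (B v) ≤ 2 * (S ∩ starPairs Z B).card := by
  rw [sum_edgeDeg, ← image_filter_sigma]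
  refine Finset.card_le_mul_card_image _ _ fun e _ => ?_
  induction e with
  | h u v =>
    refine (Finset.card_le_card (t := {⟨u, v⟩, ⟨v, u⟩}) ?_).trans Finset.card_le_two
    rintro ⟨a, b⟩ h
    have h' := (Finset.mem_filter.1 h).2
    rw [Sym2.eq_iff] at h'
    rcases h' with ⟨h1, h2⟩ | ⟨h1, h2⟩ <;> simp only at h1 h2 <;> subst h1 h2 <;> simp

omit [Fintype V] in
lemma card_starPairs_le (Z : Finset V) (B : V → Finset V) :
    (starPairs Z B).card ≤ ∑ v ∈ Z, (B v).card := by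
  rw [← Finset.card_sigma]
  exact Finset.card_image_le

-- If the targets avoid `Z`, each pair has only one end in `Z`, so no pair is listed twice.
omit [Fintype V] in
lemma card_starPairs {Z : Finset V} {B : V → Finset V} (h : ∀ v ∈ Z, Disjoint (B v) Z) :
    (starPairs Z B).card = ∑ v ∈ Z, (B v).card := by
  rw [← Finset.card_sigma]
  refine Finset.card_image_of_injOn ?_
  rintro ⟨a, b⟩ h1 ⟨c, d⟩ h2 h3
  simp only [Finset.mem_coe, Finset.mem_sigma] at h1 h2
  rcases Sym2.eq_iff.1 h3 with ⟨h4, h5⟩ | ⟨h4, h5⟩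
  · simp only at h4 h5
    subst h4 h5
    rfl
  · simp only at h4 h5
    subst h4 h5
    exact absurd h2.1 (Finset.disjoint_left.1 (h _ h1.1) h1.2)

/-- A choice of a color for every vertex of `Z` can be made within a family of size `k ^ |Z|`. -/
lemma exists_choice_family {k : ℕ} (σ : V → Fin k) (Z : Finset V) :
    ∃ I : Finset (V → Fin k), I.card ≤ k ^ Z.card ∧ ∀ R : V → Fin k → Prop,
      (∀ v ∈ Z, ∃ j, R v j) → ∃ g ∈ I, ∀ v ∈ Z, R v (g v) := by
  classical
  refine ⟨(Finset.univ : Finset (Z → Fin k)).image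
    (fun g v => if h : v ∈ Z then g ⟨v, h⟩ else σ v), ?_, ?_⟩
  · refine Finset.card_image_le.trans ?_
    simp
  · intro R h
    choose f hf using h
    refine ⟨_, Finset.mem_image_of_mem _ (Finset.mem_univ fun v : Z => f v v.2), fun v hv => ?_⟩
    simpa [hv] using hf v hv

/-! ### Low-degree vertices and the two bad events -/

open Classical in
/-- The vertices outside of `Y` that have at most `r` neighbors outside of `Y` in some color class
other than their own. -/
noncomputable def lowDeg {k : ℕ} (σ : V → Fin k) (r : ℝ) (S : Finset (Sym2 V)) (Y : Finset V) :
    Finset V :=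
  Finset.univ.filter fun v =>
    v ∉ Y ∧ ∃ j, j ≠ σ v ∧ (edgeDeg S v (colorClass σ j \ Y) : ℝ) ≤ r

lemma mem_lowDeg {k : ℕ} {σ : V → Fin k} {r : ℝ} {S : Finset (Sym2 V)} {Y : Finset V} {v : V} :
    v ∈ lowDeg σ r S Y ↔
      v ∉ Y ∧ ∃ j, j ≠ σ v ∧ (edgeDeg S v (colorClass σ j \ Y) : ℝ) ≤ r := by
  simp [lowDeg]

/-- The probability that all vertices of a given set have a low degree into some color class. -/
lemma subsetProb_subset_lowDeg_le {k : ℕ} (σ : V → Fin k) {p r b : ℝ} (h0 : 0 ≤ p) (h1 : p ≤ 1)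
    (Y Z : Finset V) (hb : ∀ j, b ≤ (colorClass σ j \ (Z ∪ Y)).card) :
    subsetProb p (crossPairs σ) (fun S => Z ⊆ lowDeg σ r S Y) ≤
      (k * Real.exp (5 * r - 0.99 * (p * b))) ^ Z.card := by
  classical
  obtain ⟨I, hI, hI'⟩ := exists_choice_family σ Z
  set F : (V → Fin k) → Finset (Sym2 V) := fun g =>
    starPairs Z fun v => colorClass σ (g v) \ (Z ∪ Y) with hF
  -- Only colors different from the vertex's own are kept, so that all pairs of `F g` are
  -- bichromatic and hence random.
  set I' := I.filter fun g => ∀ v ∈ Z, g v ≠ σ v with hI'def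
  have step1 : subsetProb p (crossPairs σ) (fun S => Z ⊆ lowDeg σ r S Y) ≤
      subsetProb p (crossPairs σ) (fun S => ∃ g ∈ I', ((S ∩ F g).card : ℝ) ≤ r * Z.card) := by
    refine subsetProb_mono h0 h1 fun S _ hS => ?_
    obtain ⟨g, hg, hgR⟩ := hI' (fun v j => j ≠ σ v ∧ (edgeDeg S v (colorClass σ j \ Y) : ℝ) ≤ r)
      (fun v hv => (mem_lowDeg.1 (hS hv)).2)
    refine ⟨g, Finset.mem_filter.2 ⟨hg, fun v hv => (hgR v hv).1⟩, ?_⟩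
    have h2 : ((S ∩ F g).card : ℝ) ≤
        ∑ v ∈ Z, (edgeDeg S v (colorClass σ (g v) \ (Z ∪ Y)) : ℝ) := by
      exact_mod_cast card_inter_starPairs_le S Z _
    refine h2.trans ?_
    rw [mul_comm, ← nsmul_eq_mul]
    refine Finset.sum_le_card_nsmul _ _ _ fun v hv => le_trans ?_ (hgR v hv).2
    exact_mod_cast edgeDeg_mono (Finset.sdiff_subset_sdiff le_rfl Finset.subset_union_right)
  have step2 : ∀ g ∈ I', subsetProb p (crossPairs σ)
      (fun S => ((S ∩ F g).card : ℝ) ≤ r * Z.card) ≤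
      Real.exp (5 * r - 0.99 * (p * b)) ^ Z.card := by
    intro g hg
    have hg2 := (Finset.mem_filter.1 hg).2
    have hFsub : F g ⊆ crossPairs σ := by
      intro e he
      simp only [hF, starPairs, Finset.mem_image, Finset.mem_sigma] at he
      obtain ⟨⟨v, u⟩, ⟨hv, hu⟩, rfl⟩ := he
      rw [mem_crossPairs]
      have := (mem_colorClass.1 (Finset.mem_sdiff.1 hu).1)
      rw [this]
      exact (hg2 v hv).symm
    have hFcard : b * Z.card ≤ ((F g).card : ℝ) := by
      have : (F g).card = _ := card_starPairs (Z := Z)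
        (B := fun v => colorClass σ (g v) \ (Z ∪ Y)) fun v _ =>
          Finset.disjoint_left.2 fun u hu hZ =>
            (Finset.mem_sdiff.1 hu).2 (Finset.mem_union_left _ hZ)
      rw [this, mul_comm, ← nsmul_eq_mul]
      push_cast
      exact Finset.card_nsmul_le_sum _ _ _ fun v _ => hb _
    -- Chernoff bound for the lower tail with tilt `exp(-5)`; since this is at most `0.01`, only one
    -- percent of the mean is lost in the exponent.
    have h3 : subsetProb p (crossPairs σ) (fun S => ((S ∩ F g).card : ℝ) ≤ r * Z.card) ≤
        subsetAvg p (crossPairs σ)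
          (fun S => Real.exp (5 * (r * Z.card)) * Real.exp (-5) ^ (S ∩ F g).card) := by
      refine subsetProb_le_avg h0 h1 (fun S _ => by positivity) fun S _ hS => ?_
      rw [← Real.exp_nat_mul, ← Real.exp_add]
      exact Real.one_le_exp (by linarith)
    refine h3.trans ?_
    rw [subsetAvg_const_mul, subsetAvg_pow_card_inter, Finset.inter_eq_right.2 hFsub]
    have he5 : Real.exp (-5) ≤ 0.01 := by
      rw [Real.exp_neg, inv_le_comm₀ (Real.exp_pos _) (by norm_num)]
      have h27 : (2.7 : ℝ) ≤ Real.exp 1 := by linarith [Real.exp_one_gt_d9]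
      calc (0.01 : ℝ)⁻¹ ≤ 2.7 ^ 5 := by norm_num
        _ ≤ Real.exp 1 ^ 5 := by gcongr
        _ = Real.exp 5 := by rw [← Real.exp_nat_mul]; norm_num
    have h4 : 0 ≤ 1 + p * (Real.exp (-5) - 1) := by nlinarith [Real.exp_pos (-5)]
    have h5 : 1 + p * (Real.exp (-5) - 1) ≤ Real.exp (-(0.99 * p)) := by
      have := Real.add_one_le_exp (-(0.99 * p))
      nlinarith
    calc Real.exp (5 * (r * Z.card)) * (1 + p * (Real.exp (-5) - 1)) ^ (F g).card
        ≤ Real.exp (5 * (r * Z.card)) * Real.exp (-(0.99 * p)) ^ (F g).card := by gcongr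
      _ = Real.exp (5 * (r * Z.card) + (F g).card * (-(0.99 * p))) := by
          rw [← Real.exp_nat_mul, ← Real.exp_add]
      _ ≤ Real.exp (Z.card * (5 * r - 0.99 * (p * b))) := by
          apply Real.exp_le_exp.2
          nlinarith [mul_le_mul_of_nonneg_left hFcard h0]
      _ = _ := by rw [Real.exp_nat_mul]
  calc _ ≤ _ := step1
    _ ≤ ∑ g ∈ I', subsetProb p (crossPairs σ) (fun S => ((S ∩ F g).card : ℝ) ≤ r * Z.card) :=
        subsetProb_exists_le h0 h1 _ _ _
    _ ≤ ∑ g ∈ I', Real.exp (5 * r - 0.99 * (p * b)) ^ Z.card := Finset.sum_le_sum step2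
    _ = I'.card * Real.exp (5 * r - 0.99 * (p * b)) ^ Z.card := by simp
    _ ≤ (k ^ Z.card : ℕ) * Real.exp (5 * r - 0.99 * (p * b)) ^ Z.card := by
        have : I'.card ≤ k ^ Z.card := (Finset.card_filter_le _ _).trans hI
        gcongr
    _ = _ := by push_cast; rw [mul_pow]

/-- Many vertices have a low degree, within few color classes. -/
def ManyLowDeg {k : ℕ} (σ : V → Fin k) (r a : ℝ) (s : ℕ) (Y : Finset V)
    (S : Finset (Sym2 V)) : Prop :=
  ∃ (J : Finset (Fin k)) (Z : Finset V), (J.card : ℝ) * a ≤ s + a ∧ Z ⊆ lowDeg σ r S Y ∧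
    (∀ v ∈ Z, σ v ∈ J) ∧ Z.card = s

/-- Union bound over `J` (at most `2 ^ k` choices) and over the `s`-subsets of the classes in `J`.
As `a ≤ s` gives `|J| ≤ 2s/a`, these classes have at most `2sc/a` vertices, so the entropy per
vertex depends on `c/a` and not on `n/s`. -/
lemma subsetProb_manyLowDeg_le {k : ℕ} (σ : V → Fin k) {p r a b c : ℝ} {s : ℕ} (h0 : 0 ≤ p)
    (h1 : p ≤ 1) (Y : Finset V) (ha : 0 < a) (has : a ≤ s)
    (hb : ∀ j, b + s + Y.card ≤ (colorClass σ j).card) (hc : ∀ j, (colorClass σ j).card ≤ c)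
    (hc0 : 0 ≤ c) :
    subsetProb p (crossPairs σ) (ManyLowDeg σ r a s Y) ≤
      2 ^ k * (2 * Real.exp 1 * (c / a) * (k * Real.exp (5 * r - 0.99 * (p * b)))) ^ s := by
  classical
  set q : ℝ := k * Real.exp (5 * r - 0.99 * (p * b)) with hq
  have hq0 : 0 ≤ q := by positivity
  have hs0' : (0 : ℝ) < s := ha.trans_le has
  have hs0 : 0 < s := by exact_mod_cast hs0'
  set 𝓙 := (Finset.univ : Finset (Finset (Fin k))).filter fun J => (J.card : ℝ) * a ≤ s + a
  set VJ : Finset (Fin k) → Finset V := fun J => Finset.univ.filter fun v => σ v ∈ J with hVJ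
  have step1 : subsetProb p (crossPairs σ) (ManyLowDeg σ r a s Y) ≤
      subsetProb p (crossPairs σ) (fun S => ∃ J ∈ 𝓙, ∃ Z ∈ (VJ J).powersetCard s,
        Z ⊆ lowDeg σ r S Y) := by
    refine subsetProb_mono h0 h1 fun S _ hS => ?_
    obtain ⟨J, Z, hJ, hZ, hZJ, hZs⟩ := hS
    refine ⟨J, by simpa [𝓙] using hJ, Z, ?_, hZ⟩
    rw [Finset.mem_powersetCard]
    exact ⟨fun v hv => by simpa [hVJ] using hZJ v hv, hZs⟩
  have step2 : ∀ J, ∀ Z ∈ (VJ J).powersetCard s,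
      subsetProb p (crossPairs σ) (fun S => Z ⊆ lowDeg σ r S Y) ≤ q ^ s := by
    intro J Z hZ
    have hZs := (Finset.mem_powersetCard.1 hZ).2
    have := subsetProb_subset_lowDeg_le σ (r := r) (b := b) h0 h1 Y Z ?_
    · rwa [hZs] at this
    · intro j
      have h2 := Finset.le_card_sdiff (Z ∪ Y) (colorClass σ j)
      have h3 := Finset.card_union_le Z Y
      have h4 : (colorClass σ j).card ≤ (colorClass σ j \ (Z ∪ Y)).card + (s + Y.card) := by omega
      have h5 : ((colorClass σ j).card : ℝ) ≤ (colorClass σ j \ (Z ∪ Y)).card + (s + Y.card) := by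
        exact_mod_cast h4
      linarith [hb j]
  have step3 : ∀ J ∈ 𝓙, (((VJ J).powersetCard s).card : ℝ) ≤ (2 * Real.exp 1 * (c / a)) ^ s := by
    intro J hJ
    have hJ' : (J.card : ℝ) * a ≤ s + a := by simpa [𝓙] using hJ
    have hVJcard : ((VJ J).card : ℝ) ≤ J.card * c := by
      have h2 : (VJ J).card = ∑ j ∈ J, (colorClass σ j).card := by
        rw [Finset.card_eq_sum_card_fiberwise (f := σ) (t := J)
          (fun v hv => by simpa [hVJ] using hv)]
        refine Finset.sum_congr rfl fun j hj => congrArg _ ?_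
        ext v
        simp only [hVJ, Finset.mem_filter, Finset.mem_univ, true_and, mem_colorClass,
          and_iff_right_iff_imp]
        rintro rfl
        exact hj
      rw [h2, ← nsmul_eq_mul]
      push_cast
      exact Finset.sum_le_card_nsmul _ _ _ fun j _ => hc j
    rw [Finset.card_powersetCard]
    refine (choose_le_exp_mul_div_pow _ s hs0).trans ?_
    have h3 : ((VJ J).card : ℝ) / s ≤ 2 * (c / a) := by
      rw [div_le_iff₀ hs0']
      have h4 : (J.card : ℝ) ≤ 2 * s / a := by
        rw [le_div_iff₀ ha]; linarith
      calc ((VJ J).card : ℝ) ≤ J.card * c := hVJcard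
        _ ≤ 2 * s / a * c := by gcongr
        _ = _ := by ring
    calc (Real.exp 1 * (((VJ J).card : ℝ) / s)) ^ s ≤ (Real.exp 1 * (2 * (c / a))) ^ s := by gcongr
      _ = _ := by ring
  calc _ ≤ _ := step1
    _ ≤ ∑ J ∈ 𝓙, ∑ Z ∈ (VJ J).powersetCard s,
        subsetProb p (crossPairs σ) (fun S => Z ⊆ lowDeg σ r S Y) :=
        (subsetProb_exists_le h0 h1 _ _ _).trans
          (Finset.sum_le_sum fun J _ => subsetProb_exists_le h0 h1 _ _ _)
    _ ≤ ∑ J ∈ 𝓙, ∑ Z ∈ (VJ J).powersetCard s, q ^ s :=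
        Finset.sum_le_sum fun J _ => Finset.sum_le_sum fun Z hZ => step2 J Z hZ
    _ = ∑ J ∈ 𝓙, (((VJ J).powersetCard s).card : ℝ) * q ^ s := by simp
    _ ≤ ∑ J ∈ 𝓙, (2 * Real.exp 1 * (c / a)) ^ s * q ^ s :=
        Finset.sum_le_sum fun J hJ => mul_le_mul_of_nonneg_right (step3 J hJ) (by positivity)
    _ = 𝓙.card * ((2 * Real.exp 1 * (c / a)) ^ s * q ^ s) := by simp
    _ ≤ 2 ^ k * ((2 * Real.exp 1 * (c / a)) ^ s * q ^ s) := by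
        have h5 : 𝓙.card ≤ 2 ^ k := (Finset.card_filter_le _ _).trans (by simp)
        have h6 : (𝓙.card : ℝ) ≤ 2 ^ k := by exact_mod_cast h5
        gcongr
    _ = _ := by rw [← mul_pow]

/-- Few vertices have a low degree in each color class, but every vertex of `Y` has many neighbors
among these vertices and `Y`. -/
def DenseAround {k : ℕ} (σ : V → Fin k) (r r' a : ℝ) (Y : Finset V) (S : Finset (Sym2 V)) : Prop :=
  (∀ j, ((lowDeg σ r S Y ∩ colorClass σ j).card : ℝ) ≤ a) ∧
    ∀ v ∈ Y, ∃ j, r' ≤ (edgeDeg S v ((lowDeg σ r S Y ∩ colorClass σ j) ∪ Y) : ℝ)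

/-- The pairs avoiding `Y` are exposed first; they determine `lowDeg σ r S Y`. The pairs meeting `Y`
are still independent, and a union bound over colors `g v` with an upper-tail Chernoff bound
applies. The tilt is `exp(2t)` because an edge inside `Y` counts for both ends. -/
lemma subsetProb_denseAround_le {k : ℕ} (σ : V → Fin k) {p r r' a t : ℝ} (h0 : 0 ≤ p)
    (h1 : p ≤ 1) (Y : Finset V) (ht : 0 ≤ t) :
    subsetProb p (crossPairs σ) (DenseAround σ r r' a Y) ≤
      (k * Real.exp (p * (a + Y.card) * Real.exp (2 * t) - t * r')) ^ Y.card := by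
  classical
  set P : Sym2 V → Prop := fun e => ∀ v ∈ Y, v ∉ e with hP
  refine subsetProb_le_of_forall_fiber h0 h1 _ P _ fun S₁ hS₁ => ?_
  set E₂ := (crossPairs σ).filter (fun e => ¬ P e) with hE₂
  set A := lowDeg σ r S₁ Y with hA
  have hlow : ∀ S₂ ⊆ E₂, lowDeg σ r (S₁ ∪ S₂) Y = A := by
    intro S₂ hS₂
    ext v
    rw [hA, mem_lowDeg, mem_lowDeg]
    refine and_congr_right fun hv => ?_
    refine exists_congr fun j => and_congr_right fun _ => ?_
    rw [edgeDeg_congr fun u hu => ?_]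
    rw [Finset.mem_union, or_iff_left_iff_imp]
    intro h
    refine absurd ?_ (Finset.mem_filter.1 (hS₂ h)).2
    intro w hw hw'
    rcases Sym2.mem_iff.1 hw' with rfl | rfl
    · exact hv hw
    · exact (Finset.mem_sdiff.1 hu).2 hw
  have hdeg : ∀ S₂ : Finset (Sym2 V), ∀ v ∈ Y, ∀ B, edgeDeg (S₁ ∪ S₂) v B = edgeDeg S₂ v B := by
    intro S₂ v hv B
    refine edgeDeg_congr fun u _ => ?_
    rw [Finset.mem_union, or_iff_right_iff_imp]
    intro h
    exact absurd (Sym2.mem_mk_left v u) ((Finset.mem_filter.1 (hS₁ h)).2 v hv)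
  obtain ⟨I, hI, hI'⟩ := exists_choice_family σ Y
  set F : (V → Fin k) → Finset (Sym2 V) := fun g =>
    starPairs Y fun v => (A ∩ colorClass σ (g v)) ∪ Y with hF
  set ρ : ℝ := Real.exp (p * (a + Y.card) * Real.exp (2 * t) - t * r') with hρ
  -- The size condition depends on `S₁` only; where it fails the event is impossible on the whole
  -- fiber.
  by_cases hAa : ∀ j, ((A ∩ colorClass σ j).card : ℝ) ≤ a
  swap
  · have : subsetProb p E₂ (fun S₂ => DenseAround σ r r' a Y (S₁ ∪ S₂)) ≤
        subsetAvg p E₂ (fun _ => 0 * 1) := by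
      refine subsetProb_le_avg h0 h1 (fun _ _ => by simp) fun S₂ hS₂ hQ => ?_
      have := hQ.1
      rw [hlow S₂ hS₂] at this
      exact absurd this hAa
    refine this.trans ?_
    rw [subsetAvg_const_mul, zero_mul]
    positivity
  have step1 : subsetProb p E₂ (fun S₂ => DenseAround σ r r' a Y (S₁ ∪ S₂)) ≤
      subsetProb p E₂ (fun S₂ => ∃ g ∈ I, r' * Y.card ≤ 2 * ((S₂ ∩ F g).card : ℝ)) := by
    refine subsetProb_mono h0 h1 fun S₂ hS₂ hQ => ?_
    obtain ⟨g, hg, hgR⟩ := hI' _ hQ.2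
    refine ⟨g, hg, ?_⟩
    have h2 : (∑ v ∈ Y, (edgeDeg S₂ v ((A ∩ colorClass σ (g v)) ∪ Y) : ℝ)) ≤
        2 * ((S₂ ∩ F g).card : ℝ) := by
      exact_mod_cast sum_edgeDeg_le S₂ Y fun v => (A ∩ colorClass σ (g v)) ∪ Y
    refine le_trans ?_ h2
    rw [mul_comm, ← nsmul_eq_mul]
    refine Finset.card_nsmul_le_sum _ _ _ fun v hv => ?_
    have := hgR v hv
    rwa [hlow S₂ hS₂, hdeg S₂ v hv] at this
  have step2 : ∀ g ∈ I, subsetProb p E₂ (fun S₂ => r' * Y.card ≤ 2 * ((S₂ ∩ F g).card : ℝ)) ≤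
      ρ ^ Y.card := by
    intro g _
    have h3 : subsetProb p E₂ (fun S₂ => r' * Y.card ≤ 2 * ((S₂ ∩ F g).card : ℝ)) ≤
        subsetAvg p E₂
          (fun S => Real.exp (-(t * (r' * Y.card))) * Real.exp (2 * t) ^ (S ∩ F g).card) := by
      refine subsetProb_le_avg h0 h1 (fun S _ => by positivity) fun S _ hS => ?_
      rw [← Real.exp_nat_mul, ← Real.exp_add]
      exact Real.one_le_exp (by nlinarith)
    refine h3.trans ?_
    rw [subsetAvg_const_mul, subsetAvg_pow_card_inter]
    have hFcard : ((E₂ ∩ F g).card : ℝ) ≤ Y.card * (a + Y.card) := by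
      have h4 : ((F g).card : ℝ) ≤ ∑ v ∈ Y, (((A ∩ colorClass σ (g v)) ∪ Y).card : ℝ) := by
        exact_mod_cast card_starPairs_le Y fun v => (A ∩ colorClass σ (g v)) ∪ Y
      have h5 : ((E₂ ∩ F g).card : ℝ) ≤ (F g).card := by
        exact_mod_cast Finset.card_le_card Finset.inter_subset_right
      refine (h5.trans h4).trans ?_
      rw [← nsmul_eq_mul]
      refine Finset.sum_le_card_nsmul _ _ _ fun v _ => ?_
      have h6 : (((A ∩ colorClass σ (g v)) ∪ Y).card : ℝ) ≤
          (A ∩ colorClass σ (g v)).card + Y.card := by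
        exact_mod_cast Finset.card_union_le _ _
      linarith [hAa (g v)]
    have h7 : 1 ≤ Real.exp (2 * t) := Real.one_le_exp (by linarith)
    have h8 : 0 ≤ 1 + p * (Real.exp (2 * t) - 1) := by nlinarith
    have h9 : 1 + p * (Real.exp (2 * t) - 1) ≤ Real.exp (p * Real.exp (2 * t)) := by
      have := Real.add_one_le_exp (p * Real.exp (2 * t))
      nlinarith
    calc Real.exp (-(t * (r' * Y.card))) * (1 + p * (Real.exp (2 * t) - 1)) ^ (E₂ ∩ F g).card
        ≤ Real.exp (-(t * (r' * Y.card))) * Real.exp (p * Real.exp (2 * t)) ^ (E₂ ∩ F g).card := by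
          gcongr
      _ = Real.exp (-(t * (r' * Y.card)) + (E₂ ∩ F g).card * (p * Real.exp (2 * t))) := by
          rw [← Real.exp_nat_mul, ← Real.exp_add]
      _ ≤ Real.exp (Y.card * (p * (a + Y.card) * Real.exp (2 * t) - t * r')) := by
          apply Real.exp_le_exp.2
          have : 0 ≤ p * Real.exp (2 * t) := by positivity
          nlinarith [mul_le_mul_of_nonneg_right hFcard this]
      _ = _ := by rw [Real.exp_nat_mul]
  calc _ ≤ _ := step1
    _ ≤ ∑ g ∈ I, subsetProb p E₂ (fun S₂ => r' * Y.card ≤ 2 * ((S₂ ∩ F g).card : ℝ)) :=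
        subsetProb_exists_le h0 h1 _ _ _
    _ ≤ ∑ g ∈ I, ρ ^ Y.card := Finset.sum_le_sum step2
    _ = I.card * ρ ^ Y.card := by simp
    _ ≤ (k ^ Y.card : ℕ) * ρ ^ Y.card := by gcongr
    _ = _ := by push_cast; rw [mul_pow]

end Degrees

/-! ### The whitening process -/

section Whitening

/-- Every vertex of `W` has at most one neighbor outside of `W` in some color class other than
its own. -/
def IsWhitenable {V : Type*} [Fintype V] [DecidableEq V] {k : ℕ} (σ : V → Fin k)
    (S : Finset (Sym2 V)) (W : Finset V) : Prop :=
  ∀ v ∈ W, ∃ j, j ≠ σ v ∧ edgeDeg S v (colorClass σ j \ W) ≤ 1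

variable {V : Type*} [Fintype V] [DecidableEq V]

/-- The white set stays whitenable because enlarging it only lowers outside degrees. It gains one
vertex per step, so the number of white vertices outside any fixed `U` skips no value; this supplies
an intermediate set of prescribed size. -/
lemma whitening_invariant {G : SimpleGraph V} {k : ℕ} {σ : G.Coloring (Fin k)}
    {ζ : V → Fin (k + 1)} (U : Finset V)
    (h : Relation.ReflTransGen (WhiteningStep G) (fun v => (σ v).succ) ζ) :
    (∀ v, ζ v = 0 ∨ ζ v = (σ v).succ) ∧
      IsWhitenable σ (edges G) (Finset.univ.filter fun v => ζ v = 0) ∧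
      ∀ y ≤ ((Finset.univ.filter fun v => ζ v = 0) \ U).card,
        ∃ W, IsWhitenable σ (edges G) W ∧ (W \ U).card = y := by
  induction h with
  | refl =>
    have : (Finset.univ.filter fun v => (σ v).succ = 0) = (∅ : Finset V) := by
      ext v; simp
    refine ⟨fun v => Or.inr rfl, ?_, fun y hy => ⟨∅, ?_, ?_⟩⟩
    · simp only [this]
      exact fun v hv => absurd hv (Finset.notMem_empty v)
    · exact fun v hv => absurd hv (Finset.notMem_empty v)
    · simp only [this, Finset.empty_sdiff, Finset.card_empty, Nat.le_zero] at hy ⊢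
      exact hy.symm
  | @tail ζ ζ' _ hstep ih =>
    obtain ⟨ih1, ih2, ih3⟩ := ih
    obtain ⟨v, hv0, hvs, rfl⟩ := hstep
    set W := Finset.univ.filter fun v => ζ v = 0 with hW
    have hW' : (Finset.univ.filter fun u => Function.update ζ v 0 u = 0) = insert v W := by
      ext u
      by_cases huv : u = v
      · subst huv; simp
      · simp [hW, huv]
    have hvσ : ζ v = (σ v).succ := (ih1 v).resolve_left hv0
    have hT : IsWhitenable σ (edges G) (insert v W) := by
      intro u hu
      have hmono : ∀ j, colorClass σ j \ insert v W ⊆ colorClass σ j \ W := fun j =>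
        Finset.sdiff_subset_sdiff le_rfl (Finset.subset_insert _ _)
      rcases Finset.mem_insert.1 hu with rfl | hu
      · have h2 : ∃ j : Fin (k + 1), j ≠ 0 ∧ j ≠ ζ u ∧ ∀ u₁ u₂ : V, u₁ ≠ u₂ → G.Adj u u₁ →
            G.Adj u u₂ → ζ u₁ = j → ζ u₂ ≠ j := by
          by_contra hcon
          push Not at hcon
          exact hvs ⟨hv0, fun j hj hj' => hcon j hj hj'⟩
        obtain ⟨j, hj0, hju, hj⟩ := h2
        obtain ⟨i, rfl⟩ := Fin.exists_succ_eq.2 hj0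
        refine ⟨i, ?_, (edgeDeg_mono (hmono i)).trans ?_⟩
        · rintro rfl
          exact hju hvσ.symm
        · refine Finset.card_le_one.2 fun a ha b hb => ?_
          have key : ∀ c ∈ (colorClass σ i \ W).filter (fun c => s(u, c) ∈ edges G),
              G.Adj u c ∧ ζ c = i.succ := by
            intro c hc
            rw [Finset.mem_filter, Finset.mem_sdiff, mem_colorClass, mem_edges] at hc
            refine ⟨hc.2, ?_⟩
            have hc0 : ζ c ≠ 0 := fun h => hc.1.2 (by simp [hW, h])
            rw [(ih1 c).resolve_left hc0, hc.1.1]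
          by_contra hab
          exact hj a b hab (key a ha).1 (key b hb).1 (key a ha).2 (key b hb).2
      · obtain ⟨j, hj, hd⟩ := ih2 u hu
        exact ⟨j, hj, (edgeDeg_mono (hmono j)).trans hd⟩
    refine ⟨fun u => ?_, ?_, fun y hy => ?_⟩
    · by_cases huv : u = v
      · subst huv; simp
      · simpa [huv] using ih1 u
    · rw [hW']; exact hT
    · rw [hW'] at hy
      by_cases hy' : y ≤ (W \ U).card
      · exact ih3 y hy'
      · refine ⟨insert v W, hT, le_antisymm ?_ hy⟩
        have : (insert v W \ U).card ≤ (W \ U).card + 1 := by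
          refine (Finset.card_le_card (t := insert v (W \ U)) ?_).trans
            (Finset.card_insert_le _ _)
          intro u hu
          simp only [Finset.mem_sdiff, Finset.mem_insert] at hu ⊢
          tauto
        omega

lemma lowDeg_inter_colorClass_card_lt {k s : ℕ} {σ : V → Fin k} {r a : ℝ} {Y : Finset V}
    {S : Finset (Sym2 V)} (h : ¬ ManyLowDeg σ r a s Y S) (j : Fin k) :
    (lowDeg σ r S Y ∩ colorClass σ j).card < s := by
  by_contra hs
  obtain ⟨Z, hZ, hZs⟩ := Finset.exists_subset_card_eq (not_lt.1 hs)
  refine h ⟨{j}, Z, by simp, hZ.trans Finset.inter_subset_left, fun v hv => ?_, hZs⟩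
  simpa using (Finset.mem_inter.1 (hZ hv)).2

/-- A vertex of `W` outside `lowDeg σ r S ∅` has more than `r` neighbors in the color where it sees
at most one vertex outside `W`. The others, more than `r - 1 ≥ r'`, lie in `W`. -/
lemma denseAround_of_isWhitenable {k s : ℕ} {σ : V → Fin k} {r r' a : ℝ} {S : Finset (Sym2 V)}
    {W : Finset V} (hr : r' + 1 ≤ r) (hW : IsWhitenable σ S W)
    (h : ¬ ManyLowDeg σ r a s (W \ lowDeg σ r S ∅) S) :
    DenseAround σ r r' s (W \ lowDeg σ r S ∅) S := by
  refine ⟨fun j => by exact_mod_cast (lowDeg_inter_colorClass_card_lt h j).le, fun v hv => ?_⟩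
  obtain ⟨hvW, hvU⟩ := Finset.mem_sdiff.1 hv
  obtain ⟨j, hj, hd⟩ := hW v hvW
  refine ⟨j, ?_⟩
  have h1 : r < edgeDeg S v (colorClass σ j) := by
    by_contra hcon
    exact hvU (mem_lowDeg.2 ⟨Finset.notMem_empty v, j, hj, by simpa using hcon⟩)
  have h2 : edgeDeg S v (colorClass σ j) ≤ edgeDeg S v (colorClass σ j \ W) +
      edgeDeg S v (lowDeg σ r S (W \ lowDeg σ r S ∅) ∩ colorClass σ j ∪ W \ lowDeg σ r S ∅) := by
    refine edgeDeg_le_add fun u hu => ?_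
    by_cases huW : u ∈ W
    · refine Finset.mem_union_right _ ?_
      by_cases huU : u ∈ lowDeg σ r S ∅
      · refine Finset.mem_union_left _ (Finset.mem_inter.2 ⟨?_, hu⟩)
        obtain ⟨-, i, hi, hid⟩ := mem_lowDeg.1 huU
        -- Ignoring neighbors in `Y` can only lower degrees, so a low-degree vertex outside `Y`
        -- stays one relative to `Y`.
        refine mem_lowDeg.2 ⟨fun h => (Finset.mem_sdiff.1 h).2 huU, i, hi, le_trans ?_ hid⟩
        exact_mod_cast edgeDeg_mono (Finset.sdiff_subset_sdiff le_rfl (Finset.empty_subset _))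
      · exact Finset.mem_union_right _ (Finset.mem_sdiff.2 ⟨huW, huU⟩)
    · exact Finset.mem_union_left _ (Finset.mem_sdiff.2 ⟨hu, huW⟩)
  have h3 : (edgeDeg S v (colorClass σ j) : ℝ) ≤ 1 +
      edgeDeg S v (lowDeg σ r S (W \ lowDeg σ r S ∅) ∩ colorClass σ j ∪ W \ lowDeg σ r S ∅) := by
    exact_mod_cast h2.trans (Nat.add_le_add_right hd _)
  linarith

-- Indices are added until the sum first reaches `s`. Before the last one the sum was below `s`, so
-- all but one index contribute at most `s/a` in number.
omit [Fintype V] [DecidableEq V] in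
lemma exists_subset_sum_ge_card_le {ι : Type*} [DecidableEq ι] (f : ι → ℕ) {a : ℝ} (ha : 0 ≤ a)
    {s : ℕ} (J : Finset ι) (hJ : ∀ j ∈ J, a ≤ f j) (hs : s ≤ ∑ j ∈ J, f j) :
    ∃ J' ⊆ J, s ≤ ∑ j ∈ J', f j ∧ (J'.card : ℝ) * a ≤ s + a := by
  induction J using Finset.induction_on with
  | empty => exact ⟨∅, le_rfl, hs, by simp; positivity⟩
  | insert i J hi ih =>
    by_cases h : s ≤ ∑ j ∈ J, f j
    · obtain ⟨J', h1, h2⟩ := ih (fun j hj => hJ j (Finset.mem_insert_of_mem hj)) h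
      exact ⟨J', h1.trans (Finset.subset_insert _ _), h2⟩
    · refine ⟨insert i J, le_rfl, hs, ?_⟩
      have h1 : (J.card : ℝ) * a ≤ ∑ j ∈ J, (f j : ℝ) := by
        rw [← nsmul_eq_mul]
        exact Finset.card_nsmul_le_sum _ _ _ fun j hj => hJ j (Finset.mem_insert_of_mem hj)
      have h2 : ∑ j ∈ J, (f j : ℝ) ≤ s := by exact_mod_cast (not_le.1 h).le
      rw [Finset.card_insert_of_notMem hi]
      push_cast
      linarith

lemma sum_lowDeg_lt {k s : ℕ} {σ : V → Fin k} {r a : ℝ} (ha : 0 ≤ a) {Y : Finset V}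
    {S : Finset (Sym2 V)} (h : ¬ ManyLowDeg σ r a s Y S) (J : Finset (Fin k))
    (hJ : ∀ j ∈ J, a ≤ (lowDeg σ r S Y ∩ colorClass σ j).card) :
    ∑ j ∈ J, (lowDeg σ r S Y ∩ colorClass σ j).card < s := by
  by_contra hs
  obtain ⟨J', -, h2, h3⟩ := exists_subset_sum_ge_card_le _ ha J hJ (not_lt.1 hs)
  have h4 : ∑ j ∈ J', (lowDeg σ r S Y ∩ colorClass σ j).card
      = ((lowDeg σ r S Y).filter fun v => σ v ∈ J').card := by
    rw [Finset.card_eq_sum_card_fiberwise (s := (lowDeg σ r S Y).filter fun v => σ v ∈ J') (f := σ)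
      (t := J') (fun v hv => by simpa using (Finset.mem_filter.1 hv).2)]
    refine Finset.sum_congr rfl fun j hj => congrArg _ ?_
    ext v
    simp only [Finset.mem_inter, mem_colorClass, Finset.mem_filter]
    constructor
    · rintro ⟨h, rfl⟩
      exact ⟨⟨h, hj⟩, rfl⟩
    · rintro ⟨⟨h, -⟩, rfl⟩
      exact ⟨h, rfl⟩
  rw [h4] at h2
  obtain ⟨Z, hZ, hZs⟩ := Finset.exists_subset_card_eq h2
  exact h ⟨J', Z, h3, hZ.trans (Finset.filter_subset _ _),
    fun v hv => (Finset.mem_filter.1 (hZ hv)).2, hZs⟩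

lemma sum_card_inter_colorClass {k : ℕ} (σ : V → Fin k) (A : Finset V) :
    ∑ j, (A ∩ colorClass σ j).card = A.card := by
  rw [Finset.card_eq_sum_card_fiberwise (f := σ) (t := Finset.univ)
    (fun _ _ => Finset.mem_univ _)]
  refine Finset.sum_congr rfl fun j _ => congrArg _ ?_
  ext v
  simp

/-- If neither of the two bad events occurs, then the whitened vertices are those of low degree and
a small additional set. -/
lemma whitening_classSize {n k s y : ℕ} {G : SimpleGraph (Fin n)} {σ : G.Coloring (Fin k)}
    {ζ : Fin n → Fin (k + 1)} {r r' a : ℝ} (hr : r' + 1 ≤ r) (ha : 0 ≤ a)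
    (h : Relation.ReflTransGen (WhiteningStep G) (fun v => (σ v).succ) ζ)
    (h0 : ¬ ManyLowDeg σ r a s ∅ (edges G))
    (hy : ∀ Y : Finset (Fin n), Y.card = y → ¬ ManyLowDeg σ r a s Y (edges G) ∧
      ¬ DenseAround σ r r' s Y (edges G)) :
    ∃ f g : Fin k → ℕ, classSize ζ 0 ≤ ∑ j, f j + ∑ j, g j ∧ ∑ j, g j ≤ y ∧
      (∀ J : Finset (Fin k), (∀ j ∈ J, a ≤ f j) → ∑ j ∈ J, f j ≤ s) ∧
      ∀ j, classSize ζ j.succ ≤ (colorClass σ j).card ∧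
        (colorClass σ j).card ≤ classSize ζ j.succ + f j + g j := by
  set U := lowDeg σ r (edges G) ∅ with hU
  obtain ⟨h1, h2, h3⟩ := whitening_invariant U h
  set W := Finset.univ.filter fun v => ζ v = 0 with hW
  have hWcard : classSize ζ 0 = W.card := by
    rw [classSize, ← Set.ncard_coe_finset]
    congr 1
    ext v
    simp [hW]
  have hclass : ∀ j : Fin k, classSize ζ j.succ = (colorClass σ j \ W).card := by
    intro j
    rw [classSize, ← Set.ncard_coe_finset]
    congr 1
    ext v
    simp only [Set.mem_preimage, Set.mem_singleton_iff, Finset.coe_sdiff, Set.mem_sdiff,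
      Finset.mem_coe, mem_colorClass, hW, Finset.mem_filter, Finset.mem_univ, true_and]
    constructor
    · intro hv
      have hv0 : ζ v ≠ 0 := by rw [hv]; exact Fin.succ_ne_zero j
      refine ⟨?_, hv0⟩
      rw [(h1 v).resolve_left hv0] at hv
      exact Fin.succ_injective _ hv
    · rintro ⟨rfl, hv0⟩
      exact (h1 v).resolve_left hv0
  refine ⟨fun j => (U ∩ colorClass σ j).card, fun j => ((W \ U) ∩ colorClass σ j).card,
    ?_, ?_, ?_, ?_⟩
  · rw [sum_card_inter_colorClass, sum_card_inter_colorClass, hWcard]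
    have : W ⊆ U ∪ (W \ U) := by
      intro v hv
      by_cases hvU : v ∈ U <;> simp [hv, hvU]
    exact (Finset.card_le_card this).trans (Finset.card_union_le _ _)
  · rw [sum_card_inter_colorClass]
    by_contra hcon
    obtain ⟨W', hT, hW'⟩ := h3 y (not_le.1 hcon).le
    exact (hy _ hW').2 (denseAround_of_isWhitenable hr hT (hy _ hW').1)
  · exact fun J hJ => (sum_lowDeg_lt ha h0 J hJ).le
  · intro j
    rw [hclass]
    refine ⟨Finset.card_le_card Finset.sdiff_subset, ?_⟩
    have : colorClass σ j ⊆ (colorClass σ j \ W) ∪ (U ∩ colorClass σ j)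
        ∪ ((W \ U) ∩ colorClass σ j) := by
      intro v hv
      simp only [Finset.mem_union, Finset.mem_sdiff, Finset.mem_inter, hv]
      tauto
    exact (Finset.card_le_card this).trans ((Finset.card_union_le _ _).trans
      (Nat.add_le_add_right (Finset.card_union_le _ _) _))

end Whitening

/-! ### The number of colorings with given class sizes -/

/-- The sum of the squares of the relative deviations of the class sizes from their average. -/
noncomputable def imbalance {n k : ℕ} (σ : Fin n → Fin k) : ℝ :=
  ∑ j, ((k : ℝ) * (colorClass σ j).card / n - 1) ^ 2

lemma imbalance_nonneg {n k : ℕ} (σ : Fin n → Fin k) : 0 ≤ imbalance σ :=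
  Finset.sum_nonneg fun _ _ => sq_nonneg _

/-- The linear terms of the squared deviations are fixed by the total `n`, so `imbalance` is exactly
the loss of bichromatic pairs against equal classes. -/
lemma two_mul_card_crossPairs_eq {n k : ℕ} (hn : 0 < n) (hk : 0 < k) (σ : Fin n → Fin k) :
    2 * ((crossPairs σ).card : ℝ) = (n : ℝ) ^ 2 * (1 - (1 / k + imbalance σ / k ^ 2)) := by
  have hn' : (0 : ℝ) < n := by exact_mod_cast hn
  have hk' : (0 : ℝ) < k := by exact_mod_cast hk
  have h1 : 2 * ((crossPairs σ).card : ℝ) + ∑ j, ((colorClass σ j).card : ℝ) ^ 2 = (n : ℝ) ^ 2 := by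
    exact_mod_cast (two_mul_card_crossPairs σ).trans (by simp)
  have h2 : ∑ j, ((colorClass σ j).card : ℝ) = n := by
    exact_mod_cast (sum_card_colorClass σ).trans (by simp)
  have h3 : imbalance σ = (k : ℝ) ^ 2 / n ^ 2 * ∑ j, ((colorClass σ j).card : ℝ) ^ 2 - k := by
    have : ∀ j, ((k : ℝ) * (colorClass σ j).card / n - 1) ^ 2
        = (k : ℝ) ^ 2 / n ^ 2 * ((colorClass σ j).card : ℝ) ^ 2
          - 2 * k / n * (colorClass σ j).card + 1 := by
      intro j; field_simp; ring
    unfold imbalance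
    simp only [this]
    rw [Finset.sum_add_distrib, Finset.sum_sub_distrib, ← Finset.mul_sum, ← Finset.mul_sum, h2]
    simp
    field_simp
    ring
  rw [h3]
  have h4 : ∑ j, ((colorClass σ j).card : ℝ) ^ 2 = (n : ℝ) ^ 2 - 2 * ((crossPairs σ).card : ℝ) := by
    linarith
  rw [h4]
  field_simp
  ring

lemma two_mul_card_pairs {n : ℕ} :
    2 * ((crossPairs (id : Fin n → Fin n)).card : ℝ) = (n : ℝ) * (n - 1) := by
  have h1 := two_mul_card_crossPairs (id : Fin n → Fin n)
  have h2 : ∀ j, colorClass (id : Fin n → Fin n) j = {j} := by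
    intro j; ext v; simp
  simp only [h2, Finset.card_singleton, one_pow, Finset.sum_const, Finset.card_univ,
    Fintype.card_fin, smul_eq_mul, mul_one] at h1
  have h3 : 2 * ((crossPairs (id : Fin n → Fin n)).card : ℝ) + n = (n : ℝ) ^ 2 := by
    exact_mod_cast h1
  linarith

lemma one_sub_le_exp_neg_sub_sq {z : ℝ} (h0 : 0 ≤ z) (h1 : z ≤ 1) :
    1 - z ≤ Real.exp (-(z + z ^ 2 / 2)) := by
  rcases h1.eq_or_lt with rfl | h1
  · simp only [sub_self]; positivity
  · have h := Real.hasSum_pow_div_log_of_abs_lt_one (x := z) (by rw [abs_of_nonneg h0]; exact h1)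
    have h2 := sum_le_hasSum (Finset.range 2) (fun i _ => by positivity) h
    simp only [Finset.sum_range_succ, Finset.sum_range_zero] at h2
    norm_num at h2
    rw [← Real.exp_log (show 0 < 1 - z by linarith)]
    exact Real.exp_le_exp.2 (by linarith)

/-- The ratio is `(1 - z) n/(n - 1)` with `z = 1/k + imbalance/k²`. The second-order term of `ln(1 -
z)` is kept: its part `1/(2k²)` later cancels the `-ln k` in the lower bound on `d`. -/
lemma card_crossPairs_div_pow_le {n k m : ℕ} (hn : 2 ≤ n) (hk : 0 < k) (σ : Fin n → Fin k) {d : ℝ}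
    (hd : 0 ≤ d) (hm : d * n / 2 ≤ m) :
    ((crossPairs σ).card / (crossPairs (id : Fin n → Fin n)).card : ℝ) ^ m ≤
      Real.exp (2 * m / n) *
        Real.exp (-(d * n / 2 * (1 / k + 1 / (2 * k ^ 2) + imbalance σ / k ^ 2))) := by
  have hn' : (2 : ℝ) ≤ n := by exact_mod_cast hn
  have hk' : (0 : ℝ) < k := by exact_mod_cast hk
  have hX := imbalance_nonneg σ
  set z : ℝ := 1 / k + imbalance σ / k ^ 2 with hz
  have hz0 : 0 ≤ z := by positivity
  have hzk : 1 / (k : ℝ) ≤ z := by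
    have : 0 ≤ imbalance σ / k ^ 2 := by positivity
    linarith
  have hM := two_mul_card_crossPairs_eq (by omega) hk σ
  have hN := two_mul_card_pairs (n := n)
  rw [← hz] at hM
  have hz1 : z ≤ 1 := by
    by_contra hcon
    have h1 : (n : ℝ) ^ 2 * (1 - z) < 0 :=
      mul_neg_of_pos_of_neg (by positivity) (by linarith [not_le.1 hcon])
    have h2 : (0 : ℝ) ≤ (crossPairs σ).card := by positivity
    linarith
  have hratio : ((crossPairs σ).card / (crossPairs (id : Fin n → Fin n)).card : ℝ) ≤
      Real.exp (2 / n) * Real.exp (-(z + z ^ 2 / 2)) := by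
    have h1 : ((crossPairs σ).card / (crossPairs (id : Fin n → Fin n)).card : ℝ) =
        (n / (n - 1)) * (1 - z) := by
      rw [← mul_div_mul_left _ _ (two_ne_zero' ℝ), hM, hN]
      have : (n : ℝ) - 1 ≠ 0 := by linarith
      field_simp
    have h2 : (n : ℝ) / (n - 1) ≤ Real.exp (2 / n) := by
      refine le_trans ?_ (Real.add_one_le_exp _)
      rw [div_add_one (by linarith), div_le_div_iff₀ (by linarith) (by linarith)]
      nlinarith
    rw [h1]
    exact mul_le_mul h2 (one_sub_le_exp_neg_sub_sq hz0 hz1) (by linarith) (Real.exp_pos _).le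
  have hquad : 1 / (k : ℝ) + 1 / (2 * k ^ 2) + imbalance σ / k ^ 2 ≤ z + z ^ 2 / 2 := by
    have h1 : (1 / (k : ℝ)) ^ 2 ≤ z ^ 2 := by gcongr
    have h2 : 1 / (2 * (k : ℝ) ^ 2) = (1 / (k : ℝ)) ^ 2 / 2 := by field_simp
    rw [h2]
    linarith
  calc _ ≤ (Real.exp (2 / n) * Real.exp (-(z + z ^ 2 / 2))) ^ m := by gcongr
    _ = Real.exp (2 * m / n) * Real.exp (-(m * (z + z ^ 2 / 2))) := by
        rw [mul_pow, ← Real.exp_nat_mul, ← Real.exp_nat_mul]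
        congr 2 <;> ring
    _ ≤ _ := by
        have hdn : 0 ≤ d * n / 2 := div_nonneg (mul_nonneg hd (by positivity)) two_pos.le
        gcongr

/-! ### Consequences for the class sizes of valid covers -/

/-- The error term in the estimate of the class sizes. -/
noncomputable def classError (k : ℕ) : ℝ := √(5 / Real.log k) + 103 / Real.log k

lemma tendsto_classError : Tendsto classError atTop (𝓝 0) := by
  have h1 : Tendsto (fun k : ℕ => Real.log k) atTop atTop :=
    Real.tendsto_log_atTop.comp tendsto_natCast_atTop_atTop
  have h2 := ((h1.const_div_atTop 5).sqrt).add (h1.const_div_atTop 103)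
  rw [Real.sqrt_zero, add_zero] at h2
  exact h2

lemma pow_three_mul_exp_le {L : ℝ} (hL : 1000 ≤ L) : 4 * L ^ 3 * Real.exp (-(0.7 * L)) ≤ 1 := by
  rw [Real.exp_neg, ← div_eq_mul_inv, div_le_one (Real.exp_pos _)]
  have h := Real.pow_div_factorial_le_exp (0.7 * L) (by linarith) 4
  refine le_trans ?_ h
  norm_num [Nat.factorial]
  have : 0 ≤ L ^ 3 := by positivity
  nlinarith

lemma exp_add_exp_le {L : ℝ} (hL : 1000 ≤ L) :
    Real.exp (-(0.7 * L)) + 103 / L * Real.exp (-L) ≤ Real.exp (-(2 / 3) * L) := by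
  have h1 : Real.exp (-(0.7 * L)) ≤ 1 / 2 * Real.exp (-(2 / 3) * L) := by
    have h2 : -(0.7 * L) = -(L / 30) + -(2 / 3) * L := by ring
    rw [h2, Real.exp_add]
    gcongr
    rw [Real.exp_neg, inv_le_comm₀ (Real.exp_pos _) (by norm_num)]
    have := Real.add_one_le_exp (L / 30)
    linarith
  have h3 : 103 / L * Real.exp (-L) ≤ 1 / 2 * Real.exp (-(2 / 3) * L) := by
    have h4 : Real.exp (-L) ≤ Real.exp (-(2 / 3) * L) := Real.exp_le_exp.2 (by linarith)
    have h5 : 103 / L ≤ 1 / 2 := by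
      rw [div_le_iff₀ (by linarith)]; linarith
    have : 0 ≤ Real.exp (-L) := (Real.exp_pos _).le
    exact mul_le_mul h5 h4 this (by norm_num)
  linarith

lemma abs_card_colorClass_sub_le {n k : ℕ} (hn : 0 < n) (hk : 0 < k) (σ : Fin n → Fin k) {δ : ℝ}
    (h : imbalance σ ≤ δ) (j : Fin k) :
    |((colorClass σ j).card : ℝ) - n / k| ≤ √δ * (n / k) := by
  have hn' : (0 : ℝ) < n := by exact_mod_cast hn
  have hk' : (0 : ℝ) < k := by exact_mod_cast hk
  have h1 : ((k : ℝ) * (colorClass σ j).card / n - 1) ^ 2 ≤ δ :=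
    (Finset.single_le_sum (f := fun j => ((k : ℝ) * (colorClass σ j).card / n - 1) ^ 2)
      (fun _ _ => sq_nonneg _) (Finset.mem_univ j)).trans h
  have h2 := Real.abs_le_sqrt h1
  have h3 : ((colorClass σ j).card : ℝ) - n / k
      = ((k : ℝ) * (colorClass σ j).card / n - 1) * (n / k) := by field_simp
  rw [h3, abs_mul, abs_of_pos (show (0 : ℝ) < n / k by positivity)]
  gcongr

lemma card_mul_le_of_forall_lt {ι : Type*} {J : Finset ι} {f : ι → ℕ} {x B : ℝ}
    (h : ∀ j ∈ J, x < f j) (hB : ((∑ j ∈ J, f j : ℕ) : ℝ) ≤ B) : (J.card : ℝ) * x ≤ B := by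
  refine le_trans ?_ hB
  push_cast
  rw [← nsmul_eq_mul]
  exact Finset.card_nsmul_le_sum _ _ _ fun j hj => (h j hj).le

/-- The properties of a cover claimed in the theorem follow from estimates for the class sizes of a
coloring and the numbers of whitened vertices. -/
lemma cover_properties {n k s y : ℕ} {a : ℝ} (hk : 0 < k) (hn : 0 < n) (hL : 1000 ≤ Real.log k)
    (σ : Fin n → Fin k) (hσ : imbalance σ ≤ 5 / Real.log k) (ζ : Fin n → Fin (k + 1))
    (ha : a = Real.exp (-(0.7 * Real.log k)) * (n / k))
    (hs0 : a ≤ s) (hs : (s : ℝ) ≤ 101 / Real.log k * (n / k))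
    (hy : (y : ℝ) ≤ 2 / Real.log k * (n / k)) (f g : Fin k → ℕ)
    (h0 : classSize ζ 0 ≤ ∑ j, f j + ∑ j, g j) (hg : ∑ j, g j ≤ y)
    (hf : ∀ J : Finset (Fin k), (∀ j ∈ J, a ≤ f j) → ∑ j ∈ J, f j ≤ s)
    (hζ : ∀ j, classSize ζ j.succ ≤ (colorClass σ j).card ∧
      (colorClass σ j).card ≤ classSize ζ j.succ + f j + g j) :
    (classSize ζ 0 : ℝ) ≤ (n : ℝ) * (k : ℝ) ^ (-(2 / 3) : ℝ) ∧
      (∀ i : Fin (k + 1), i ≠ 0 →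
        |(classSize ζ i : ℝ) - (n : ℝ) / k| ≤ classError k * ((n : ℝ) / k)) ∧
      (({i : Fin (k + 1) | i ≠ 0 ∧
          (n : ℝ) / ((k : ℝ) * Real.log k ^ 3) <
            |(classSize ζ i : ℝ) - (n : ℝ) / k|}.ncard : ℕ) : ℝ)
        ≤ Real.log k ^ 9 := by
  classical
  have hn' : (0 : ℝ) < n := by exact_mod_cast hn
  have hk' : (0 : ℝ) < k := by exact_mod_cast hk
  set L := Real.log k with hLdef
  have hL0 : 0 < L := by linarith
  have hexpL : Real.exp L = k := Real.exp_log hk'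
  set c : ℝ := n / k with hc
  have hc0 : 0 < c := by positivity
  have hdev : ∀ j, |(classSize ζ j.succ : ℝ) - c| ≤
      |((colorClass σ j).card : ℝ) - c| + (f j + g j) := by
    intro j
    obtain ⟨h1, h2⟩ := hζ j
    have h1' : (classSize ζ j.succ : ℝ) ≤ (colorClass σ j).card := by exact_mod_cast h1
    have h2' : ((colorClass σ j).card : ℝ) ≤ classSize ζ j.succ + f j + g j := by exact_mod_cast h2
    have h3 := abs_le.1 (le_refl |((colorClass σ j).card : ℝ) - c|)
    rw [abs_le]
    constructor <;> linarith [h3.1, h3.2, (Nat.cast_nonneg (f j) : (0 : ℝ) ≤ f j),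
      (Nat.cast_nonneg (g j) : (0 : ℝ) ≤ g j)]
  have hgy : ((∑ j, g j : ℕ) : ℝ) ≤ 2 / L * c := le_trans (by exact_mod_cast hg) hy
  have hgJ : ∀ J : Finset (Fin k), ((∑ j ∈ J, g j : ℕ) : ℝ) ≤ 2 / L * c := by
    intro J
    refine le_trans ?_ hgy
    exact_mod_cast Finset.sum_le_sum_of_subset (Finset.subset_univ J)
  have hfJ : ∀ J : Finset (Fin k), (∀ j ∈ J, a ≤ f j) →
      ((∑ j ∈ J, f j : ℕ) : ℝ) ≤ 101 / L * c := fun J hJ =>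
    le_trans (by exact_mod_cast hf J hJ) hs
  have hf1 : ∀ j, (f j : ℝ) ≤ 101 / L * c := by
    intro j
    by_cases hj : a ≤ f j
    · simpa using hfJ {j} (by simpa using hj)
    · exact (not_le.1 hj).le.trans (hs0.trans hs)
  have hg1 : ∀ j, (g j : ℝ) ≤ 2 / L * c := fun j => by simpa using hgJ {j}
  refine ⟨?_, ?_, ?_⟩
  -- Classes with `f j < a` contribute at most `a` each, the remaining ones at most `s` in total.
  · have h1 : ((∑ j, f j : ℕ) : ℝ) ≤ k * a + 101 / L * c := by
      rw [← Finset.sum_filter_add_sum_filter_not Finset.univ (fun j => a ≤ (f j : ℝ)),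
        Nat.cast_add, add_comm]
      refine add_le_add ?_ (hfJ _ fun j hj => (Finset.mem_filter.1 hj).2)
      have ha0 : 0 ≤ a := by rw [ha]; positivity
      calc ((∑ j ∈ Finset.univ.filter (fun j => ¬ a ≤ (f j : ℝ)), f j : ℕ) : ℝ)
          ≤ (Finset.univ.filter (fun j => ¬ a ≤ (f j : ℝ))).card • a := by
            push_cast
            exact Finset.sum_le_card_nsmul _ _ _ fun j hj =>
              (not_le.1 (Finset.mem_filter.1 hj).2).le
        _ ≤ k * a := by
            rw [nsmul_eq_mul]
            gcongr
            exact (Finset.card_filter_le _ _).trans (by simp)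
    have h2 : (classSize ζ 0 : ℝ) ≤ ((∑ j, f j : ℕ) : ℝ) + ((∑ j, g j : ℕ) : ℝ) := by
      exact_mod_cast h0
    have h3 : (k : ℝ) ^ (-(2 / 3) : ℝ) = Real.exp (-(2 / 3) * L) := by
      rw [Real.rpow_def_of_pos hk', mul_comm]
    have h4 : c = n * Real.exp (-L) := by
      rw [Real.exp_neg, hexpL, hc]; rfl
    have h5 : k * a = n * Real.exp (-(0.7 * L)) := by
      rw [ha, hc]; field_simp
    rw [h3]
    calc (classSize ζ 0 : ℝ) ≤ k * a + 103 / L * c := by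
          have : (101 / L + 2 / L) * c = 103 / L * c := by ring
          linarith
      _ = n * (Real.exp (-(0.7 * L)) + 103 / L * Real.exp (-L)) := by
          rw [h5, h4]; ring
      _ ≤ _ := by
          gcongr
          exact exp_add_exp_le hL
  · intro i hi
    obtain ⟨j, rfl⟩ := Fin.exists_succ_eq.2 hi
    have h1 := abs_card_colorClass_sub_le hn hk σ hσ j
    have h2 : classError k * c = √(5 / L) * c + (101 / L * c + 2 / L * c) := by
      rw [classError]; ring
    rw [h2]
    exact (hdev j).trans (add_le_add h1 (add_le_add (hf1 j) (hg1 j)))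
  -- The threshold `c/L³` equals `4x = 2x + x + x`: a class above it is exceptional through its size
  -- under `σ` (`J₁`), through `f` (`J₂`) or through `g` (`J₃`). The first kind is counted by
  -- `imbalance`, the other two by the totals of `f` and `g`.
  · set x : ℝ := c / (4 * L ^ 3) with hx
    have hx0 : 0 < x := by positivity
    have hxa : a ≤ x := by
      rw [hx, le_div_iff₀ (by positivity), ha]
      have := pow_three_mul_exp_le hL
      nlinarith
    set J₁ := Finset.univ.filter fun j => 2 * x < |((colorClass σ j).card : ℝ) - c| with hJ₁
    set J₂ := Finset.univ.filter fun j => x < (f j : ℝ) with hJ₂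
    set J₃ := Finset.univ.filter fun j => x < (g j : ℝ) with hJ₃
    have hsub : {i : Fin (k + 1) | i ≠ 0 ∧ (n : ℝ) / ((k : ℝ) * L ^ 3) <
        |(classSize ζ i : ℝ) - (n : ℝ) / k|} ⊆
        (((J₁ ∪ J₂ ∪ J₃).image Fin.succ : Finset (Fin (k + 1))) : Set (Fin (k + 1))) := by
      rintro i ⟨hi, h⟩
      obtain ⟨j, rfl⟩ := Fin.exists_succ_eq.2 hi
      have h4 : (n : ℝ) / ((k : ℝ) * L ^ 3) = 4 * x := by
        rw [hx, hc]; field_simp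
      rw [h4] at h
      refine Finset.mem_coe.2 (Finset.mem_image_of_mem _ ?_)
      simp only [Finset.mem_union, hJ₁, hJ₂, hJ₃, Finset.mem_filter, Finset.mem_univ, true_and]
      by_contra hcon
      push Not at hcon
      linarith [hdev j, hcon.1.1, hcon.1.2, hcon.2]
    have hcard : {i : Fin (k + 1) | i ≠ 0 ∧ (n : ℝ) / ((k : ℝ) * L ^ 3) <
        |(classSize ζ i : ℝ) - (n : ℝ) / k|}.ncard ≤ J₁.card + J₂.card + J₃.card := by
      refine (Set.ncard_le_ncard hsub (Set.toFinite _)).trans ?_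
      rw [Set.ncard_coe_finset]
      refine Finset.card_image_le.trans ((Finset.card_union_le _ _).trans ?_)
      exact Nat.add_le_add_right (Finset.card_union_le _ _) _
    have hb₁ : (J₁.card : ℝ) ≤ 20 * L ^ 5 := by
      have h1 : (J₁.card : ℝ) * (1 / (4 * L ^ 6)) ≤ 5 / L := by
        refine le_trans ?_ hσ
        rw [← nsmul_eq_mul]
        refine le_trans (Finset.card_nsmul_le_sum J₁
          (fun j => ((k : ℝ) * (colorClass σ j).card / n - 1) ^ 2) _ fun j hj => ?_)
          (Finset.sum_le_sum_of_subset_of_nonneg (Finset.subset_univ _)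
            fun _ _ _ => sq_nonneg _)
        have h2 := (Finset.mem_filter.1 hj).2
        have h3 : ((colorClass σ j).card : ℝ) - c
            = ((k : ℝ) * (colorClass σ j).card / n - 1) * c := by rw [hc]; field_simp
        rw [h3, abs_mul, abs_of_pos hc0] at h2
        have h4 : 1 / (2 * L ^ 3) ≤ |(k : ℝ) * (colorClass σ j).card / n - 1| := by
          have h5 : 2 * x = 1 / (2 * L ^ 3) * c := by rw [hx]; field_simp; norm_num
          rw [h5] at h2
          exact (lt_of_mul_lt_mul_right h2 hc0.le).le
        calc 1 / (4 * L ^ 6) = (1 / (2 * L ^ 3)) ^ 2 := by field_simp; norm_num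
          _ ≤ |(k : ℝ) * (colorClass σ j).card / n - 1| ^ 2 := by gcongr
          _ = _ := sq_abs _
      rw [mul_one_div, div_le_div_iff₀ (by positivity) hL0] at h1
      have h2 : (J₁.card : ℝ) * L ≤ 20 * L ^ 5 * L := by linarith [h1]
      exact le_of_mul_le_mul_right h2 hL0
    have hb₂ : (J₂.card : ℝ) ≤ 404 * L ^ 2 := by
      have h1 : (J₂.card : ℝ) * x ≤ 101 / L * c :=
        card_mul_le_of_forall_lt (fun j hj => (Finset.mem_filter.1 hj).2)
          (hfJ J₂ fun j hj => hxa.trans (Finset.mem_filter.1 hj).2.le)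
      have h2 : 101 / L * c = 404 * L ^ 2 * x := by rw [hx]; field_simp; norm_num
      rw [h2] at h1
      exact le_of_mul_le_mul_right h1 hx0
    have hb₃ : (J₃.card : ℝ) ≤ 8 * L ^ 2 := by
      have h1 : (J₃.card : ℝ) * x ≤ 2 / L * c :=
        card_mul_le_of_forall_lt (fun j hj => (Finset.mem_filter.1 hj).2) (hgJ J₃)
      have h2 : 2 / L * c = 8 * L ^ 2 * x := by rw [hx]; field_simp; norm_num
      rw [h2] at h1
      exact le_of_mul_le_mul_right h1 hx0
    calc _ ≤ ((J₁.card + J₂.card + J₃.card : ℕ) : ℝ) := by exact_mod_cast hcard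
      _ ≤ 20 * L ^ 5 + 404 * L ^ 2 + 8 * L ^ 2 := by push_cast; linarith
      _ ≤ L ^ 9 := by
          have e1 : L ^ 2 ≤ L ^ 5 := pow_le_pow_right₀ (by linarith) (by norm_num)
          have e2 : L ^ 9 = L ^ 4 * L ^ 5 := by ring
          have e3 : (1000 : ℝ) ^ 4 ≤ L ^ 4 := by gcongr
          have e4 : 0 ≤ L ^ 5 := by positivity
          nlinarith [mul_le_mul_of_nonneg_right e3 e4]

/-! ### The probability of the bad events -/

/-- The coloring is unbalanced, or one of the two bad events occurs for the empty set or for some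
set of `y` vertices. -/
def BadColoring {n k : ℕ} (δ r r' a : ℝ) (s y : ℕ) (σ : Fin n → Fin k)
    (S : Finset (Sym2 (Fin n))) : Prop :=
  δ < imbalance σ ∨ ManyLowDeg σ r a s ∅ S ∨
    ∃ Y ∈ (Finset.univ : Finset (Fin n)).powersetCard y,
      ManyLowDeg σ r a s Y S ∨ DenseAround σ r r' s Y S

lemma large_of_exp_le {L : ℝ} (hL : 400 * Real.exp 4000 ≤ L) : 1000000 ≤ L := by
  have := Real.add_one_le_exp (4000 : ℝ)
  linarith

lemma four_mul_exp_one_le : 4 * Real.exp 1 ≤ Real.exp 3 := by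
  have h1 : (4 : ℝ) ≤ Real.exp 2 := by
    have h27 : (2.7 : ℝ) ≤ Real.exp 1 := by linarith [Real.exp_one_gt_d9]
    calc (4 : ℝ) ≤ 2.7 ^ 2 := by norm_num
      _ ≤ Real.exp 1 ^ 2 := by gcongr
      _ = Real.exp 2 := by rw [← Real.exp_nat_mul]; norm_num
  calc 4 * Real.exp 1 ≤ Real.exp 2 * Real.exp 1 := by gcongr
    _ = Real.exp 3 := by rw [← Real.exp_add]; norm_num

/-- Exponent per vertex, up to a constant: `0.7L` for its position, `L` for the missed color,
`0.05L` from the tilt, against `0.99 · 0.97 · 1.99 L > 1.9L`. The surplus `0.1L` over `s ≥ 100c/L`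
vertices gives `10c`. -/
lemma subsetProb_manyLowDeg_le_exp {n k s : ℕ} {L c p a : ℝ} (hk : Real.exp L = k)
    (hL : 1000000 ≤ L) (hc : 0 < c) (h0 : 0 ≤ p) (h1 : p ≤ 1) (hp : 1.99 * L ≤ p * c)
    (ha : a = Real.exp (-(0.7 * L)) * c) (has : a ≤ s) (hs1 : 100 / L * c ≤ s)
    (hs2 : (s : ℝ) ≤ 101 / L * c) (σ : Fin n → Fin k)
    (hσ : ∀ j, |((colorClass σ j).card : ℝ) - c| ≤ 0.01 * c) (Y : Finset (Fin n))
    (hY : (Y.card : ℝ) ≤ 2 / L * c) :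
    subsetProb p (crossPairs σ) (ManyLowDeg σ (L / 100) a s Y) ≤ 2 ^ k * Real.exp (-(10 * c)) := by
  have ha0 : 0 < a := by rw [ha]; positivity
  have hL0 : 0 < L := by linarith
  have h103 : 103 / L * c ≤ 0.02 * c := by
    gcongr
    rw [div_le_iff₀ hL0]; linarith
  have hadd : 101 / L * c + 2 / L * c = 103 / L * c := by ring
  refine (subsetProb_manyLowDeg_le σ (b := 0.97 * c) (c := 2 * c) h0 h1 Y ha0 has
    (fun j => ?_) (fun j => ?_) (by positivity)).trans ?_
  · have := (abs_le.1 (hσ j)).1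
    linarith
  · have := (abs_le.1 (hσ j)).2
    linarith
  · gcongr
    have hca : 2 * c / a = 2 * Real.exp (0.7 * L) := by
      rw [ha, Real.exp_neg]; field_simp
    have hbase : 2 * Real.exp 1 * (2 * c / a) *
        (k * Real.exp (5 * (L / 100) - 0.99 * (p * (0.97 * c)))) ≤ Real.exp (-(0.1 * L)) := by
      rw [hca, ← hk, ← Real.exp_add]
      calc 2 * Real.exp 1 * (2 * Real.exp (0.7 * L)) *
            Real.exp (L + (5 * (L / 100) - 0.99 * (p * (0.97 * c))))
          = 4 * Real.exp 1 * Real.exp (0.7 * L + (L + (5 * (L / 100) - 0.99 * (p * (0.97 * c))))) := by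
            rw [Real.exp_add (0.7 * L)]; ring
        _ ≤ Real.exp 3 * Real.exp (-(0.15 * L)) := by
            gcongr
            · exact four_mul_exp_one_le
            · linarith
        _ ≤ _ := by
            rw [← Real.exp_add]
            exact Real.exp_le_exp.2 (by linarith)
    calc _ ≤ Real.exp (-(0.1 * L)) ^ s := by gcongr
      _ = Real.exp (-(0.1 * L * s)) := by rw [← Real.exp_nat_mul]; congr 1; ring
      _ ≤ _ := by
          apply Real.exp_le_exp.2
          have h2 : 0.1 * L * (100 / L * c) = 10 * c := by field_simp; norm_num
          have h3 : 0.1 * L * (100 / L * c) ≤ 0.1 * L * s := by gcongr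
          linarith

lemma subsetProb_denseAround_le_exp {n k s : ℕ} {L c p : ℝ} (hk : Real.exp L = k)
    (hL : 400 * Real.exp 4000 ≤ L) (h0 : 0 ≤ p) (h1 : p ≤ 1) (hp : p * c ≤ 3 * L)
    (hs : (s : ℝ) ≤ 101 / L * c) (σ : Fin n → Fin k) (Y : Finset (Fin n))
    (hY1 : 1 / L * c ≤ Y.card) (hY2 : (Y.card : ℝ) ≤ 2 / L * c) :
    subsetProb p (crossPairs σ) (DenseAround σ (L / 100) (L / 200) s Y) ≤
      Real.exp (-(8 * c)) := by
  have hL6 := large_of_exp_le hL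
  have hL0 : 0 < L := by linarith
  -- With `t = 2000` the gain `t · L/200 = 10L` beats the color choice `L` and the mean term, which
  -- is at most `309 exp(4000) ≤ L`. This is the origin of the lower bound on `L`.
  refine (subsetProb_denseAround_le σ (t := 2000) h0 h1 Y (by norm_num)).trans ?_
  have h2 : p * (s + Y.card) ≤ 309 := by
    calc p * (s + Y.card) ≤ p * (101 / L * c + 2 / L * c) := by gcongr
      _ = 103 / L * (p * c) := by ring
      _ ≤ 103 / L * (3 * L) := by gcongr
      _ = 309 := by field_simp; norm_num
  have h3 : p * (s + Y.card) * Real.exp (2 * 2000) ≤ L := by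
    have h4 : Real.exp (2 * 2000) = Real.exp 4000 := by norm_num
    rw [h4]
    have : p * (s + Y.card) * Real.exp 4000 ≤ 309 * Real.exp 4000 := by gcongr
    linarith [Real.exp_pos 4000]
  have hbase : k * Real.exp (p * (s + Y.card) * Real.exp (2 * 2000) - 2000 * (L / 200)) ≤
      Real.exp (-(8 * L)) := by
    rw [← hk, ← Real.exp_add, Real.exp_le_exp]
    generalize p * (s + Y.card) * Real.exp (2 * 2000) = t at h3 ⊢
    linarith
  calc _ ≤ Real.exp (-(8 * L)) ^ Y.card := by gcongr
    _ = Real.exp (-(8 * L * Y.card)) := by rw [← Real.exp_nat_mul]; congr 1; ring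
    _ ≤ _ := by
        apply Real.exp_le_exp.2
        have h5 : 8 * L * (1 / L * c) ≤ 8 * L * Y.card := by gcongr
        have h6 : 8 * L * (1 / L * c) = 8 * c := by field_simp
        linarith

lemma choose_le_exp {n k y : ℕ} {L c : ℝ} (hk : Real.exp L = k) (hL : 1000000 ≤ L)
    (hc : c = n / k) (hc0 : 0 < c) (hy1 : 1 / L * c ≤ y) (hy2 : (y : ℝ) ≤ 2 / L * c) :
    (n.choose y : ℝ) ≤ Real.exp (3 * c) := by
  have hL0 : 0 < L := by linarith
  have hk0 : (0 : ℝ) < k := by rw [← hk]; exact Real.exp_pos L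
  have hy0' : (0 : ℝ) < y := lt_of_lt_of_le (by positivity) hy1
  have hy0 : 0 < y := by exact_mod_cast hy0'
  refine (choose_le_exp_mul_div_pow n y hy0).trans ?_
  have h1 : (n : ℝ) / y ≤ L * Real.exp L := by
    rw [div_le_iff₀ hy0', hk]
    have h2 : (n : ℝ) = L * k * (1 / L * c) := by rw [hc]; field_simp
    calc (n : ℝ) = L * k * (1 / L * c) := h2
      _ ≤ L * k * y := by gcongr
  have h3 : Real.exp 1 * L ≤ Real.exp (0.5 * L) := by
    have h4 := Real.pow_div_factorial_le_exp (0.5 * L) (by linarith) 2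
    refine le_trans ?_ h4
    have h5 : Real.exp 1 ≤ 3 := by linarith [Real.exp_one_lt_d9]
    norm_num [Nat.factorial]
    nlinarith
  calc (Real.exp 1 * ((n : ℝ) / y)) ^ y ≤ (Real.exp 1 * (L * Real.exp L)) ^ y := by gcongr
    _ = ((Real.exp 1 * L) * Real.exp L) ^ y := by ring
    _ ≤ (Real.exp (0.5 * L) * Real.exp L) ^ y := by gcongr
    _ = Real.exp (1.5 * L * y) := by
        rw [← Real.exp_add, ← Real.exp_nat_mul]; congr 1; ring
    _ ≤ _ := by
        apply Real.exp_le_exp.2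
        have h6 : 1.5 * L * y ≤ 1.5 * L * (2 / L * c) := by gcongr
        have h7 : 1.5 * L * (2 / L * c) = 3 * c := by field_simp; norm_num
        linarith

/-- There are at most `exp(3c)` sets `Y`, each bad with probability `O(exp(-8c))`; the event for the
empty set is rarer still. -/
lemma subsetProb_badColoring_le {n k s y : ℕ} {L c p a : ℝ} (hk : Real.exp L = k)
    (hL : 400 * Real.exp 4000 ≤ L) (hc : c = n / k) (hc0 : 0 < c) (h0 : 0 ≤ p) (h1 : p ≤ 1)
    (hp1 : 1.99 * L ≤ p * c) (hp2 : p * c ≤ 3 * L)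
    (ha : a = Real.exp (-(0.7 * L)) * c) (has : a ≤ s) (hs1 : 100 / L * c ≤ s)
    (hs2 : (s : ℝ) ≤ 101 / L * c) (hy1 : 1 / L * c ≤ y) (hy2 : (y : ℝ) ≤ 2 / L * c)
    (σ : Fin n → Fin k) (hσ : imbalance σ ≤ 5 / L) :
    subsetProb p (crossPairs σ) (BadColoring (5 / L) (L / 100) (L / 200) a s y σ) ≤
      3 * 2 ^ k * Real.exp (-(5 * c)) := by
  have hL6 := large_of_exp_le hL
  have hL0 : 0 < L := by linarith
  have hk0' : (0 : ℝ) < k := by rw [← hk]; exact Real.exp_pos L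
  have hk0 : 0 < k := by exact_mod_cast hk0'
  have hn0 : 0 < n := by
    rcases Nat.eq_zero_or_pos n with rfl | h
    · simp [hc] at hc0
    · exact h
  have hcls : ∀ j, |((colorClass σ j).card : ℝ) - c| ≤ 0.01 * c := by
    intro j
    have h2 := abs_card_colorClass_sub_le hn0 hk0 σ hσ j
    rw [← hc] at h2
    refine h2.trans ?_
    gcongr
    rw [Real.sqrt_le_left (by norm_num), div_le_iff₀ hL0]
    linarith
  have hmany := subsetProb_manyLowDeg_le_exp hk hL6 hc0 h0 h1 hp1 ha has hs1 hs2 σ hcls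
  have hempty := hmany ∅ (by simp; positivity)
  have hY : ∀ Y ∈ (Finset.univ : Finset (Fin n)).powersetCard y,
      subsetProb p (crossPairs σ) (fun S => ManyLowDeg σ (L / 100) a s Y S ∨
        DenseAround σ (L / 100) (L / 200) s Y S) ≤ 2 * 2 ^ k * Real.exp (-(8 * c)) := by
    intro Y hY
    have hYc := (Finset.mem_powersetCard.1 hY).2
    refine (subsetProb_or_le h0 h1 _ _ _).trans ?_
    have h2 := hmany Y (by rw [hYc]; exact hy2)
    have h3 := subsetProb_denseAround_le_exp hk hL h0 h1 hp2 hs2 σ Y (by rw [hYc]; exact hy1)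
      (by rw [hYc]; exact hy2)
    have h4 : Real.exp (-(10 * c)) ≤ Real.exp (-(8 * c)) := Real.exp_le_exp.2 (by linarith)
    have h5 : (1 : ℝ) ≤ 2 ^ k := one_le_pow₀ (by norm_num)
    have h6 := Real.exp_pos (-(8 * c))
    calc _ ≤ 2 ^ k * Real.exp (-(8 * c)) + 1 * Real.exp (-(8 * c)) := by
          refine add_le_add (h2.trans ?_) (by linarith)
          gcongr
      _ ≤ 2 ^ k * Real.exp (-(8 * c)) + 2 ^ k * Real.exp (-(8 * c)) := by gcongr
      _ = _ := by ring
  have hsplit : subsetProb p (crossPairs σ) (BadColoring (5 / L) (L / 100) (L / 200) a s y σ) ≤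
      subsetProb p (crossPairs σ) (fun S => ManyLowDeg σ (L / 100) a s ∅ S ∨
        ∃ Y ∈ (Finset.univ : Finset (Fin n)).powersetCard y,
          ManyLowDeg σ (L / 100) a s Y S ∨ DenseAround σ (L / 100) (L / 200) s Y S) :=
    subsetProb_mono h0 h1 fun S _ hS => hS.resolve_left (not_lt.2 hσ)
  have hchoose := choose_le_exp (n := n) hk hL6 hc hc0 hy1 hy2
  calc _ ≤ _ := hsplit
    _ ≤ _ := subsetProb_or_le h0 h1 _ _ _
    _ ≤ 2 ^ k * Real.exp (-(10 * c)) +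
        ∑ Y ∈ (Finset.univ : Finset (Fin n)).powersetCard y, 2 * 2 ^ k * Real.exp (-(8 * c)) :=
        add_le_add hempty ((subsetProb_exists_le h0 h1 _ _ _).trans (Finset.sum_le_sum hY))
    _ = 2 ^ k * Real.exp (-(10 * c)) + n.choose y * (2 * 2 ^ k * Real.exp (-(8 * c))) := by
        simp
    _ ≤ 2 ^ k * Real.exp (-(5 * c)) + Real.exp (3 * c) * (2 * 2 ^ k * Real.exp (-(8 * c))) := by
        gcongr
        linarith
    _ = _ := by
        have h7 : Real.exp (3 * c) * Real.exp (-(8 * c)) = Real.exp (-(5 * c)) := by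
          rw [← Real.exp_add]; congr 1; ring
        linear_combination 2 * 2 ^ k * h7

lemma planted_density_bounds {n k m : ℕ} {L d : ℝ} (hL : 1000000 ≤ L) (hLk : L ≤ k)
    (hn : 2 * k * L + 3 ≤ n) (hd1 : 1.99 * k * L ≤ d) (hd2 : d ≤ 2 * k * L)
    (hm1 : d * n / 2 ≤ m) (hm2 : (m : ℝ) ≤ d * n / 2 + 1) (σ : Fin n → Fin k)
    (hσ : imbalance σ ≤ 5 / L) :
    1.99 * L ≤ (m / (crossPairs σ).card : ℝ) * (n / k) ∧
      (m / (crossPairs σ).card : ℝ) * (n / k) ≤ 3 * L := by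
  have hL0 : 0 < L := by linarith
  have hk0' : (0 : ℝ) < k := by linarith
  have hkL : (1000000 : ℝ) ≤ k * L := by nlinarith
  have hn0' : (0 : ℝ) < n := by nlinarith
  have hM := two_mul_card_crossPairs_eq (by exact_mod_cast hn0') (by exact_mod_cast hk0') σ
  have hX := imbalance_nonneg σ
  have hz0 : 0 ≤ 1 / (k : ℝ) + imbalance σ / k ^ 2 := by positivity
  have hz1 : 1 / (k : ℝ) + imbalance σ / k ^ 2 ≤ 0.1 := by
    have h1 : 1 / (k : ℝ) ≤ 0.01 := by
      rw [div_le_iff₀ hk0']; linarith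
    have h2 : imbalance σ / k ^ 2 ≤ 0.01 := by
      rw [div_le_iff₀ (by positivity)]
      have h3 : 5 / L ≤ 1 := by rw [div_le_one hL0]; linarith
      nlinarith
    linarith
  set M : ℝ := ((crossPairs σ).card : ℝ) with hMdef
  have hM1 : 0.45 * (n : ℝ) ^ 2 ≤ M := by nlinarith [sq_nonneg (n : ℝ)]
  have hM2 : M ≤ 0.5 * (n : ℝ) ^ 2 := by nlinarith [sq_nonneg (n : ℝ)]
  have hM0 : 0 < M := lt_of_lt_of_le (by positivity) hM1
  rw [div_mul_div_comm]
  constructor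
  · rw [le_div_iff₀ (by positivity)]
    calc 1.99 * L * (M * k) ≤ 1.99 * L * (0.5 * (n : ℝ) ^ 2 * k) := by gcongr
      _ = (1.99 * k * L) * n / 2 * n := by ring
      _ ≤ d * n / 2 * n := by gcongr
      _ ≤ m * n := by gcongr
  · rw [div_le_iff₀ (by positivity)]
    have hkLn : 1000000 ≤ k * L * n := hkL.trans (le_mul_of_one_le_right (by linarith) (by linarith))
    calc (m : ℝ) * n ≤ (d * n / 2 + 1) * n := by gcongr
      _ ≤ (2 * k * L * n / 2 + 1) * n := by gcongr
      _ ≤ (1.35 * (k * L * n)) * n := by gcongr; linarith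
      _ = 3 * L * (0.45 * (n : ℝ) ^ 2 * k) := by ring
      _ ≤ 3 * L * (M * k) := by gcongr

/-- The first moment bound for bad colorings. -/
lemma sum_badColoring_le {n k m : ℕ} {L d : ℝ} (hL : 1000000 ≤ L) (hk : Real.exp L = k)
    (hn : 2 * k * L + 3 ≤ n) (hd1 : 2 * k * L - L - 4 ≤ d) (hd2 : d ≤ 2 * k * L)
    (hm1 : d * n / 2 ≤ m) (hm2 : (m : ℝ) ≤ d * n / 2 + 1) :
    ∑ σ : Fin n → Fin k, ((crossPairs σ).card / (crossPairs (id : Fin n → Fin n)).card : ℝ) ^ m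
      * ((crossPairs σ).card + 1) *
        (if imbalance σ ≤ 5 / L then 3 * 2 ^ k * Real.exp (-(5 * (n / k))) else 1) ≤
      (Real.exp (2 * k * L + 2) * (3 * 2 ^ k)) * ((n : ℝ) ^ 2 * Real.exp (-(1 / k * n))) := by
  have hL0 : 0 < L := by linarith
  have hLk : L ≤ k := by rw [← hk]; linarith [Real.add_one_le_exp L]
  have hk0' : (0 : ℝ) < k := by linarith
  have hkL : (1000000 : ℝ) ≤ k * L := by nlinarith
  have hn2' : (2 : ℝ) ≤ n := by linarith
  have hn2 : 2 ≤ n := by exact_mod_cast hn2'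
  have hk0 : 0 < k := by exact_mod_cast hk0'
  have hd3 : 1.99 * k * L ≤ d := by nlinarith
  have hd0 : 0 ≤ d := by nlinarith
  set c : ℝ := n / k with hc
  have hc0 : 0 < c := by positivity
  set q : ℝ := 1 / k + 1 / (2 * (k : ℝ) ^ 2) with hq
  have hterm : ∀ σ : Fin n → Fin k,
      ((crossPairs σ).card / (crossPairs (id : Fin n → Fin n)).card : ℝ) ^ m
      * ((crossPairs σ).card + 1) *
        (if imbalance σ ≤ 5 / L then 3 * 2 ^ k * Real.exp (-(5 * c)) else 1) ≤
      Real.exp (2 * k * L + 2) * (n : ℝ) ^ 2 * (3 * 2 ^ k) *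
        Real.exp (-(d * n / 2 * q) - 4 * c) := by
    intro σ
    have hX := imbalance_nonneg σ
    have h1 := card_crossPairs_div_pow_le hn2 hk0 σ hd0 hm1
    have h2 : Real.exp (2 * m / n) ≤ Real.exp (2 * k * L + 2) := by
      apply Real.exp_le_exp.2
      rw [div_le_iff₀ (by linarith)]
      nlinarith
    have h3 : ((crossPairs σ).card : ℝ) + 1 ≤ (n : ℝ) ^ 2 := by
      have := two_mul_card_crossPairs_eq (by omega) hk0 σ
      have hz0 : 0 ≤ 1 / (k : ℝ) + imbalance σ / k ^ 2 := by positivity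
      nlinarith [sq_nonneg (n : ℝ)]
    have h5 : (1 : ℝ) ≤ 3 * 2 ^ k := by
      have : (1 : ℝ) ≤ 2 ^ k := one_le_pow₀ (by norm_num)
      linarith
    have h4 : Real.exp (-(d * n / 2 * (q + imbalance σ / k ^ 2))) *
        (if imbalance σ ≤ 5 / L then 3 * 2 ^ k * Real.exp (-(5 * c)) else 1) ≤
        3 * 2 ^ k * Real.exp (-(d * n / 2 * q) - 4 * c) := by
      split_ifs with hσ
      · calc Real.exp (-(d * n / 2 * (q + imbalance σ / k ^ 2))) *
              (3 * 2 ^ k * Real.exp (-(5 * c)))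
            ≤ Real.exp (-(d * n / 2 * q)) * (3 * 2 ^ k * Real.exp (-(4 * c))) := by
              gcongr
              · have : 0 ≤ imbalance σ / k ^ 2 := by positivity
                linarith
              · norm_num
          _ = _ := by rw [sub_eq_add_neg, Real.exp_add]; ring
      · rw [mul_one]
        refine le_trans ?_ (le_mul_of_one_le_left (Real.exp_pos _).le h5)
        apply Real.exp_le_exp.2
        -- The threshold `5/L` is chosen so that the imbalance penalty alone exceeds `4c`.
        have h6 : 4 * c ≤ d * n / 2 * (imbalance σ / k ^ 2) := by
          calc 4 * c ≤ 4.975 * c := by gcongr; norm_num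
            _ = (1.99 * k * L) * n / 2 * (5 / L / k ^ 2) := by rw [hc]; field_simp; norm_num
            _ ≤ d * n / 2 * (imbalance σ / k ^ 2) := by
                gcongr
                exact (not_le.1 hσ).le
        linarith
    have hite : (0 : ℝ) ≤ if imbalance σ ≤ 5 / L then 3 * 2 ^ k * Real.exp (-(5 * c)) else 1 := by
      split_ifs <;> positivity
    calc _ ≤ (Real.exp (2 * k * L + 2) * Real.exp (-(d * n / 2 * (q + imbalance σ / k ^ 2)))) *
          (n : ℝ) ^ 2 *
          (if imbalance σ ≤ 5 / L then 3 * 2 ^ k * Real.exp (-(5 * c)) else 1) := by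
          refine mul_le_mul_of_nonneg_right ?_ hite
          refine mul_le_mul (h1.trans ?_) h3 (by positivity) (by positivity)
          exact mul_le_mul_of_nonneg_right h2 (Real.exp_pos _).le
      _ = Real.exp (2 * k * L + 2) * (n : ℝ) ^ 2 *
          (Real.exp (-(d * n / 2 * (q + imbalance σ / k ^ 2))) *
          (if imbalance σ ≤ 5 / L then 3 * 2 ^ k * Real.exp (-(5 * c)) else 1)) := by ring
      _ ≤ Real.exp (2 * k * L + 2) * (n : ℝ) ^ 2 *
          (3 * 2 ^ k * Real.exp (-(d * n / 2 * q) - 4 * c)) := by gcongr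
      _ = _ := by ring
  refine (Finset.sum_le_sum fun σ _ => hterm σ).trans ?_
  rw [Finset.sum_const, Finset.card_univ, Fintype.card_fun, Fintype.card_fin, Fintype.card_fin,
    nsmul_eq_mul, Nat.cast_pow]
  have hkn : (k : ℝ) ^ n = Real.exp (n * L) := by rw [← hk, ← Real.exp_nat_mul]
  have hexp : (n * L) + (-(d * n / 2 * q) - 4 * c) ≤ -(1 / k * n) := by
    have h1 : L - d / 2 * q ≤ 3 / k := by
      have hq0 : 0 ≤ q := by positivity
      have h2 : L - d / 2 * q ≤ L - (2 * k * L - L - 4) / 2 * q := by gcongr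
      refine h2.trans ?_
      -- The terms `L/(2k)` from the bound on `d` and from the second-order part of `q` cancel, so
      -- the entropy surplus per vertex is at most `3/k`; the total exponent is then at most `3c -
      -- 4c = -c`.
      have h3 : L - (2 * k * L - L - 4) / 2 * q = (2 + (L / (4 * k) + 1 / k)) / k := by
        rw [hq]; field_simp; ring
      rw [h3]
      gcongr
      have h4 : L / (4 * k) ≤ 1 / 4 := by
        rw [div_le_div_iff₀ (by positivity) (by norm_num)]; linarith
      have h5 : 1 / (k : ℝ) ≤ 1 / 4 := by
        rw [div_le_div_iff₀ hk0' (by norm_num)]; linarith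
      linarith
    have h6 : n * (L - d / 2 * q) ≤ n * (3 / k) := by gcongr
    have h7 : n * (3 / (k : ℝ)) = 3 * c := by rw [hc]; ring
    have h8 : 1 / (k : ℝ) * n = c := by rw [hc]; ring
    rw [h8]
    linarith
  calc (k : ℝ) ^ n * (Real.exp (2 * k * L + 2) * (n : ℝ) ^ 2 * (3 * 2 ^ k) *
        Real.exp (-(d * n / 2 * q) - 4 * c))
      = Real.exp (2 * k * L + 2) * (n : ℝ) ^ 2 * (3 * 2 ^ k) *
        Real.exp ((n * L) + (-(d * n / 2 * q) - 4 * c)) := by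
        rw [hkn, Real.exp_add (n * L)]; ring
    _ ≤ Real.exp (2 * k * L + 2) * (n : ℝ) ^ 2 * (3 * 2 ^ k) * Real.exp (-(1 / k * n)) := by
        gcongr
    _ = _ := by ring

lemma gnmProb_ge {n k : ℕ} {d : ℝ} (hL : 400 * Real.exp 4000 ≤ Real.log k) (hk : 0 < k)
    (hn : 2 * k * Real.log k + 3 ≤ n)
    (hd1 : 2 * (k : ℝ) * Real.log k - Real.log k - 4 ≤ d) (hd2 : d ≤ 2 * (k : ℝ) * Real.log k) :
    1 - (Real.exp (2 * k * Real.log k + 2) * (3 * 2 ^ k)) *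
        ((n : ℝ) ^ 2 * Real.exp (-(1 / k * n))) ≤
      gnmProb n ⌈d * (n : ℝ) / 2⌉₊ (fun G => ∀ ζ : Fin n → Fin (k + 1), IsValidCover G ζ →
          (classSize ζ 0 : ℝ) ≤ (n : ℝ) * (k : ℝ) ^ (-(2 / 3) : ℝ) ∧
          (∀ i : Fin (k + 1), i ≠ 0 →
            |(classSize ζ i : ℝ) - (n : ℝ) / k| ≤ classError k * ((n : ℝ) / k)) ∧
          (({i : Fin (k + 1) | i ≠ 0 ∧
              (n : ℝ) / ((k : ℝ) * Real.log k ^ 3) <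
                |(classSize ζ i : ℝ) - (n : ℝ) / k|}.ncard : ℕ) : ℝ)
            ≤ Real.log k ^ 9) := by
  have hL6 := large_of_exp_le hL
  have hk0' : (0 : ℝ) < k := by exact_mod_cast hk
  have hkL : Real.exp (Real.log k) = k := Real.exp_log hk0'
  set L := Real.log k with hLdef
  have hL0 : 0 < L := by linarith
  have hLk : L ≤ k := by rw [← hkL]; linarith [Real.add_one_le_exp L]
  have hkL' : (1000000 : ℝ) ≤ k * L := by nlinarith
  have hd3 : 1.99 * k * L ≤ d := by nlinarith
  have hn0' : (0 : ℝ) < n := by linarith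
  have hn0 : 0 < n := by exact_mod_cast hn0'
  set m := ⌈d * (n : ℝ) / 2⌉₊ with hm
  have hdn : 0 < d * n / 2 := by
    have : 0 < d := by linarith
    positivity
  have hm1 : d * n / 2 ≤ m := Nat.le_ceil _
  have hm2 : (m : ℝ) ≤ d * n / 2 + 1 := (Nat.ceil_lt_add_one hdn.le).le
  have hm0 : 0 < m := Nat.ceil_pos.2 hdn
  have hmN : m ≤ (crossPairs (id : Fin n → Fin n)).card := by
    have h1 := two_mul_card_pairs (n := n)
    have h2 : (m : ℝ) ≤ (crossPairs (id : Fin n → Fin n)).card := by nlinarith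
    exact_mod_cast h2
  set c : ℝ := n / k with hc
  have hc0 : 0 < c := by positivity
  -- Since `c/L ≥ 1`, rounding up `s` and `y` costs at most another `c/L` each.
  have hcL : 1 ≤ 1 / L * c := by
    rw [hc, div_mul_div_comm, le_div_iff₀ (by positivity)]
    nlinarith
  set a : ℝ := Real.exp (-(0.7 * L)) * c with ha
  set s := ⌈100 / L * c⌉₊ with hs
  set y := ⌈1 / L * c⌉₊ with hy
  have hs1 : 100 / L * c ≤ s := Nat.le_ceil _
  have hs2 : (s : ℝ) ≤ 101 / L * c := by
    have h1 := (Nat.ceil_lt_add_one (show 0 ≤ 100 / L * c by positivity)).le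
    have h2 : 101 / L * c = 100 / L * c + 1 / L * c := by ring
    linarith
  have hy1 : 1 / L * c ≤ y := Nat.le_ceil _
  have hy2 : (y : ℝ) ≤ 2 / L * c := by
    have h1 := (Nat.ceil_lt_add_one (show 0 ≤ 1 / L * c by positivity)).le
    have h2 : 2 / L * c = 1 / L * c + 1 / L * c := by ring
    linarith
  have has : a ≤ s := by
    refine le_trans ?_ hs1
    rw [ha]
    gcongr
    rw [le_div_iff₀ hL0]
    have h1 := pow_three_mul_exp_le (L := L) (by linarith)
    have h2 : L ≤ L ^ 3 := le_self_pow₀ (by linarith) (by norm_num)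
    have h3 := Real.exp_pos (-(0.7 * L))
    nlinarith
  have hfirst := one_sub_sum_le_gnmProb (k := k) hm0 hmN
    (fun G => ∀ ζ : Fin n → Fin (k + 1), IsValidCover G ζ →
          (classSize ζ 0 : ℝ) ≤ (n : ℝ) * (k : ℝ) ^ (-(2 / 3) : ℝ) ∧
          (∀ i : Fin (k + 1), i ≠ 0 →
            |(classSize ζ i : ℝ) - (n : ℝ) / k| ≤ classError k * ((n : ℝ) / k)) ∧
          (({i : Fin (k + 1) | i ≠ 0 ∧
              (n : ℝ) / ((k : ℝ) * L ^ 3) <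
                |(classSize ζ i : ℝ) - (n : ℝ) / k|}.ncard : ℕ) : ℝ)
            ≤ L ^ 9)
    (BadColoring (5 / L) (L / 100) (L / 200) a s y)
    (fun σ => if imbalance σ ≤ 5 / L then 3 * 2 ^ k * Real.exp (-(5 * (n / k))) else 1)
    (fun σ => by split_ifs <;> positivity)
    (fun G hG => by
      push Not at hG
      obtain ⟨ζ, ⟨-, σ, hσ, -⟩, hζ⟩ := hG
      refine ⟨σ, fun u v huv => σ.valid huv, ?_⟩
      by_contra hbad
      simp only [BadColoring, not_or, not_lt, not_exists, not_and] at hbad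
      obtain ⟨hb1, hb2, hb3⟩ := hbad
      obtain ⟨f, g, h1, h2, h3, h4⟩ := whitening_classSize (r := L / 100) (r' := L / 200) (a := a)
        (s := s) (y := y) (by linarith) (by positivity) hσ hb2
        (fun Y hY => hb3 Y (Finset.mem_powersetCard.2 ⟨Finset.subset_univ _, hY⟩))
      have hgood := cover_properties hk hn0 (by linarith) σ hb1 ζ ha has hs2 hy2 f g h1 h2 h3 h4
      exact absurd hgood.2.2 (not_le.2 (hζ hgood.1 hgood.2.1)))
    (fun σ hσm => by
      have hmM : (m : ℝ) ≤ (crossPairs σ).card := by exact_mod_cast hσm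
      have hM0 : (0 : ℝ) < (crossPairs σ).card := by
        refine lt_of_lt_of_le ?_ hmM
        exact_mod_cast hm0
      have hp0 : (0 : ℝ) ≤ m / (crossPairs σ).card := by positivity
      have hp1 : (m : ℝ) / (crossPairs σ).card ≤ 1 := (div_le_one hM0).2 hmM
      split_ifs with hσ
      · obtain ⟨hp2, hp3⟩ := planted_density_bounds hL6 hLk hn hd3 hd2 hm1 hm2 σ hσ
        exact subsetProb_badColoring_le hkL hL hc hc0 hp0 hp1 hp2 hp3 ha has hs1 hs2 hy1 hy2 σ hσ
      · exact subsetProb_le_one hp0 hp1 _ _)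
  have hsum := sum_badColoring_le hL6 hkL hn hd1 hd2 hm1 hm2
  linarith

end KCover

theorem mainTheorem4 :
    ∃ (k₀ : ℕ) (ε : ℕ → ℝ), Tendsto ε atTop (𝓝 0) ∧
      ∀ k : ℕ, k₀ ≤ k → ∀ d : ℝ,
        2 * (k : ℝ) * Real.log k - Real.log k - 4 ≤ d → d ≤ 2 * (k : ℝ) * Real.log k →
        KCover.WHP d (fun n G => ∀ ζ : Fin n → Fin (k + 1), KCover.IsValidCover G ζ →
          (KCover.classSize ζ 0 : ℝ) ≤ (n : ℝ) * (k : ℝ) ^ (-(2 / 3) : ℝ) ∧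
          (∀ i : Fin (k + 1), i ≠ 0 →
            |(KCover.classSize ζ i : ℝ) - (n : ℝ) / k| ≤ ε k * ((n : ℝ) / k)) ∧
          (({i : Fin (k + 1) | i ≠ 0 ∧
              (n : ℝ) / ((k : ℝ) * Real.log k ^ 3) <
                |(KCover.classSize ζ i : ℝ) - (n : ℝ) / k|}.ncard : ℕ) : ℝ)
            ≤ Real.log k ^ 9) := by
  have hlog : Tendsto (fun k : ℕ => Real.log k) atTop atTop :=
    Real.tendsto_log_atTop.comp tendsto_natCast_atTop_atTop
  -- The threshold only has to make `ln k` large; for fixed `k` the error is a constant times `n²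
  -- exp(-n/k)`, which tends to `0`.
  obtain ⟨k₀, hk₀⟩ := eventually_atTop.1
    ((hlog.eventually_ge_atTop (400 * Real.exp 4000)).and (eventually_gt_atTop 0))
  refine ⟨k₀, KCover.classError, KCover.tendsto_classError, fun k hk d hd1 hd2 => ?_⟩
  obtain ⟨hL, hk0⟩ := hk₀ k hk
  have hk0' : (0 : ℝ) < k := by exact_mod_cast hk0
  set C : ℝ := Real.exp (2 * k * Real.log k + 2) * (3 * 2 ^ k)
  have hlim : Tendsto (fun n : ℕ => 1 - C * ((n : ℝ) ^ 2 * Real.exp (-(1 / k * n)))) atTop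
      (𝓝 1) := by
    have h1 := (tendsto_rpow_mul_exp_neg_mul_atTop_nhds_zero 2 (1 / k : ℝ)
      (by positivity)).comp (tendsto_natCast_atTop_atTop (R := ℝ))
    simpa [Function.comp_def, neg_mul] using (h1.const_mul C).const_sub 1
  refine tendsto_of_tendsto_of_tendsto_of_le_of_le' hlim tendsto_const_nhds ?_
    (Eventually.of_forall fun n => KCover.gnmProb_le_one _ _ _)
  filter_upwards [tendsto_natCast_atTop_atTop.eventually_ge_atTop
    (2 * (k : ℝ) * Real.log k + 3)] with n hn
  exact KCover.gnmProb_ge hL hk0 hn hd1 hd2
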